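/- Let $N\ge 1$, let $\Omega\subset\mathbb{R}^N$ be a bounded open set and $0<\sigma<1$. For $u\in L^2(\mathbb{R}^N)$ vanishing outside $\Omega$ let $D^\sigma u=D(I_{1-\sigma}u)$ be the distributional Riesz fractional gradient, where $I_\alpha u(x)=\gamma_{N,\alpha}\int_{\mathbb{R}^N}\frac{u(y)}{|x-y|^{N-\alpha}}\,dy$ and $\gamma_{N,\alpha}=\Gamma(\frac{N-\alpha}2)/(\pi^{N/2}2^\alpha\Gamma(\frac\alpha2))$ (here $\Gamma$ is Euler's function). Let $H^\sigma_0(\Omega)$ be the closure of $C_c^\infty(\Omega)$ for the norm $\|u\|_{L^2(\mathbb{R}^N)}+\|D^\sigma u\|_{L^2(\mathbb{R}^N)^N}$, endowed with the (equivalent) norm $\|u\|_{H^\sigma_0(\Omega)}=\|D^\sigma u\|_{L^2(\mathbb{R}^N)^N}$. Set $2^*=\frac{2N}{N-2\sigma}$, $2^\#=\frac{2N}{N+2\sigma}$ if $\sigma<\frac N2$; $2^*=r$, $2^\#=\frac r{r-1}$ for any fixed $r\in(1,\infty)$ if $N=1$, $\sigma=\frac12$; and $2^*=\infty$, $2^\#=1$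 if $N=1$, $\sigma>\frac12$. Let $C_*$ be the constant of the Sobolev embedding $H^\sigma_0(\Omega)\hookrightarrow L^{2^*}(\Omega)$, i.e. the least $C$ with $\|u\|_{L^{2^*}(\Omega)}\le C\|u\|_{H^\sigma_0(\Omega)}$ for all $u\in H^\sigma_0(\Omega)$. Let $A:\mathbb{R}^N\to\mathbb{R}^{N\times N}$ be measurable (not necessarily symmetric) and $a_*,a^*>0$ be such that, for a.e. $x$ and all $\xi,\zeta\in\mathbb{R}^N$, $a_*|\xi|^2\le A(x)\xi\cdot\xi$ and $A(x)\xi\cdot\zeta\le a^*|\xi||\zeta|$. Let $f\in L^{2^\#}(\Omega)$, put $C_\#=C_*/a_*$ and $R_f=C_\#\|f\|_{L^{2^\#}(\Omega)}$. Let $\nu>0$ and $\varphi\in L^\infty(\mathbb{R}^N)$ with $\varphi\ge\nu$ a.e., and let $G[u](x)=\varphi(x)\Gamma(u)$, where $\Gamma$ is a real functional on $H^\sigma_0(\Omega)$. Let $\eta,E,\gamma:[0,\infty)\to(0,\infty)$ be nondecreasing functions and $R_0\le R_f$ be such that, for every $R>0$ with $R\ge R_0$ and $B_R=\{v\in H^\sigma_0(\Omega):\|v\|_{H^\sigma_0(\Omega)}\le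 R\}$, i) $0<\eta(R)\le\Gamma(u)\le E(R)$ for all $u\in B_R$; ii) $|\Gamma(u_1)-\Gamma(u_2)|\le\gamma(R)\|u_1-u_2\|_{H^\sigma_0(\Omega)}$ for all $u_1,u_2\in B_R$. If $$2C_\#\,\frac{\gamma(R_f)}{\eta(R_f)}\,\|f\|_{L^{2^\#}(\Omega)}<1,$$ then there is exactly one $u\in H^\sigma_0(\Omega)$ that solves the quasi-variational inequality $$u\in\mathbb{K}_{G[u]}:\qquad \int_{\mathbb{R}^N}AD^\sigma u\cdot D^\sigma(v-u)\ge\int_\Omega f(v-u)\quad\forall v\in\mathbb{K}_{G[u]},$$ where $\mathbb{K}_{G[u]}=\{v\in H^\sigma_0(\Omega):|D^\sigma v|\le G[u]\text{ a.e. in }\mathbb{R}^N\}$. -/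

import Mathlib

noncomputable section

namespace SigmaGrad

open MeasureTheory
open scoped ENNReal ContDiff

/-- The Euclidean space `ℝ^N`. -/
abbrev Rn (N : ℕ) : Type := EuclideanSpace ℝ (Fin N)

/-- Normalising constant `γ_{N,α}` of the Riesz kernel. -/
def rieszConst (N : ℕ) (α : ℝ) : ℝ :=
  Real.Gamma (((N : ℝ) - α) / 2) /
    (Real.pi ^ ((N : ℝ) / 2) * (2 : ℝ) ^ α * Real.Gamma (α / 2))

/-- Riesz potential `I_α u (x) = γ_{N,α} ∫ u(y) / |x - y|^{N-α} dy`. -/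
def rieszPotential {N : ℕ} (α : ℝ) (u : Rn N → ℝ) (x : Rn N) : ℝ :=
  rieszConst N α * ∫ y, u y / ‖x - y‖ ^ ((N : ℝ) - α)

/-- `v ∈ C_c^∞(U)`. -/
def IsTestFunction {N : ℕ} (U : Set (Rn N)) (v : Rn N → ℝ) : Prop :=
  ContDiff ℝ ∞ v ∧ HasCompactSupport v ∧ tsupport v ⊆ U

/-- The square integrable vector field `F` is the distributional Riesz gradient
`D^σ u = D (I_{1-σ} u)` : for all `v ∈ C_c^∞(ℝ^N)` and all `j`,
`∫ F_j v = - ∫ (I_{1-σ} u) ∂_j v`. -/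
def HasSigmaGrad {N : ℕ} (σ : ℝ) (u : Rn N → ℝ)
    (F : Lp (Rn N) 2 (volume : Measure (Rn N))) : Prop :=
  ∀ v : Rn N → ℝ, IsTestFunction Set.univ v → ∀ j : Fin N,
    ∫ x, F x j * v x =
      - ∫ x, rieszPotential (1 - σ) u x * fderiv ℝ v x (EuclideanSpace.single j 1)

/-- The `σ`-gradient is unique as an element of `L²(ℝ^N)^N`. -/
theorem HasSigmaGrad.unique {N : ℕ} {σ : ℝ} {u : Rn N → ℝ}
    {F G : Lp (Rn N) 2 (volume : Measure (Rn N))}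
    (hF : HasSigmaGrad σ u F) (hG : HasSigmaGrad σ u G) : F = G := by
  have key : ∀ j : Fin N, ∀ᵐ x : Rn N, F x j = G x j := by
    intro j
    have loc : ∀ H : Lp (Rn N) 2 (volume : Measure (Rn N)),
        LocallyIntegrable (fun x => H x j) volume := by
      intro H
      have h1 : MemLp (fun x => H x j) 2 (volume : Measure (Rn N)) :=
        ((EuclideanSpace.proj j : Rn N →L[ℝ] ℝ)).comp_memLp' (Lp.memLp H)
      exact h1.locallyIntegrable (by norm_num)
    refine ae_eq_of_integral_contDiff_smul_eq (loc F) (loc G) ?_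
    intro v hv hc
    have h := (hF v ⟨hv, hc, Set.subset_univ _⟩ j).trans
      (hG v ⟨hv, hc, Set.subset_univ _⟩ j).symm
    simpa only [smul_eq_mul, mul_comm] using h
  apply Lp.ext
  filter_upwards [ae_all_iff.2 key] with x hx
  ext j
  exact hx j

open Classical in
/-- The `σ`-gradient `D^σ u ∈ L²(ℝ^N)^N` of `u ∈ L²(ℝ^N)` (zero if there is none; it exists for
every `u ∈ H^σ_0(Ω)`, the only functions it is used for). -/
def sigmaGrad {N : ℕ} (σ : ℝ) (u : Lp ℝ 2 (volume : Measure (Rn N))) :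
    Lp (Rn N) 2 (volume : Measure (Rn N)) :=
  if h : ∃ F, HasSigmaGrad σ u F then h.choose else 0

theorem sigmaGrad_eq {N : ℕ} {σ : ℝ} {u : Lp ℝ 2 (volume : Measure (Rn N))}
    {F : Lp (Rn N) 2 (volume : Measure (Rn N))} (hF : HasSigmaGrad σ u F) :
    sigmaGrad σ u = F := by
  have h : ∃ F, HasSigmaGrad σ u F := ⟨F, hF⟩
  rw [sigmaGrad, dif_pos h]
  exact h.choose_spec.unique hF

/-- The pairs `(φ, D^σ φ) ∈ L² × (L²)^N` with `φ ∈ C_c^∞(Ω)`. -/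
def testGraph {N : ℕ} (Ω : Set (Rn N)) (σ : ℝ) :
    Set (Lp ℝ 2 (volume : Measure (Rn N)) × Lp (Rn N) 2 (volume : Measure (Rn N))) :=
  {p | (∃ φ, IsTestFunction Ω φ ∧ p.1 =ᵐ[volume] φ) ∧ HasSigmaGrad σ p.1 p.2}

/-- `H^σ_0(Ω)` : the closure of `C_c^∞(Ω)` for the norm `‖u‖_{L²} + ‖D^σ u‖_{L²}`. Its elements
are functions on `ℝ^N` (they vanish a.e. outside `Ω`). -/
def H0 {N : ℕ} (Ω : Set (Rn N)) (σ : ℝ) : Set (Lp ℝ 2 (volume : Measure (Rn N))) :=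
  {u | ∃ F, HasSigmaGrad σ u F ∧ (u, F) ∈ closure (testGraph Ω σ)}

/-- The norm `‖u‖_{H^σ_0(Ω)} = ‖D^σ u‖_{L²(ℝ^N)^N}`. -/
def normH {N : ℕ} (σ : ℝ) (u : Lp ℝ 2 (volume : Measure (Rn N))) : ℝ :=
  ‖sigmaGrad σ u‖

/-- `(p, q) = (2^*, 2^#)`. In the limit case `N = 1`, `σ = 1/2`, any `r ∈ (1, ∞)` and its
conjugate exponent are allowed. -/
def IsSobolevPair (N : ℕ) (σ : ℝ) (p q : ℝ≥0∞) : Prop :=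
  (σ < (N : ℝ) / 2 ∧ p = ENNReal.ofReal (2 * N / (N - 2 * σ)) ∧
      q = ENNReal.ofReal (2 * N / (N + 2 * σ))) ∨
  (N = 1 ∧ σ = 1 / 2 ∧ ∃ r : ℝ, 1 < r ∧ p = ENNReal.ofReal r ∧
      q = ENNReal.ofReal (r / (r - 1))) ∨
  (N = 1 ∧ 1 / 2 < σ ∧ p = ⊤ ∧ q = 1)

/-- The constant `C_*` of the embedding `H^σ_0(Ω) ↪ L^p(Ω)` : the least `C ∈ [0, ∞]` with
`‖u‖_{L^p(Ω)} ≤ C ‖u‖_{H^σ_0(Ω)}` for all `u`. -/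
def sobolevConst {N : ℕ} (Ω : Set (Rn N)) (σ : ℝ) (p : ℝ≥0∞) : ℝ≥0∞ :=
  sInf {C | ∀ u ∈ H0 Ω σ,
    eLpNorm u p (volume.restrict Ω) ≤ C * ENNReal.ofReal (normH σ u)}

/-- `C_# = C_* / a_*`. -/
def cSharp {N : ℕ} (Ω : Set (Rn N)) (σ : ℝ) (p : ℝ≥0∞) (aLow : ℝ) : ℝ≥0∞ :=
  sobolevConst Ω σ p / ENNReal.ofReal aLow

/-- `R_f = C_# ‖f‖_{L^q(Ω)}`. -/
def radius {N : ℕ} (Ω : Set (Rn N)) (σ : ℝ) (p q : ℝ≥0∞) (aLow : ℝ) (f : Rn N → ℝ) : ℝ :=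
  (cSharp Ω σ p aLow * eLpNorm f q (volume.restrict Ω)).toReal

/-- `A` is measurable and, for a.e. `x` and all `ξ, ζ`,
`a_* |ξ|² ≤ A(x)ξ·ξ` and `A(x)ξ·ζ ≤ a^* |ξ| |ζ|`. -/
def IsEllipticMatrix {N : ℕ} (A : Rn N → Matrix (Fin N) (Fin N) ℝ) (aLow aUp : ℝ) : Prop :=
  (∀ i j, AEMeasurable (fun x => A x i j) volume) ∧
  ∀ᵐ x, ∀ ξ ζ : Rn N,
    aLow * ‖ξ‖ ^ 2 ≤ inner ℝ (Matrix.toEuclideanLin (A x) ξ) ξ ∧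
    inner ℝ (Matrix.toEuclideanLin (A x) ξ) ζ ≤ aUp * ‖ξ‖ * ‖ζ‖

/-- The convex set `K_g^σ = {v ∈ H^σ_0(Ω) : |D^σ v| ≤ g a.e. in ℝ^N}`. -/
def constraintSet {N : ℕ} (Ω : Set (Rn N)) (σ : ℝ) (g : Rn N → ℝ) :
    Set (Lp ℝ 2 (volume : Measure (Rn N))) :=
  {v | v ∈ H0 Ω σ ∧ ∀ᵐ x, ‖sigmaGrad σ v x‖ ≤ g x}

/-- `u` solves the quasi-variational inequality with threshold operator `G` :
`u ∈ K_{G[u]}` and `∫ A D^σ u · D^σ (v - u) ≥ ∫_Ω f (v - u)` for all `v ∈ K_{G[u]}`. -/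
def IsQVISolution {N : ℕ} (Ω : Set (Rn N)) (σ : ℝ) (A : Rn N → Matrix (Fin N) (Fin N) ℝ)
    (f : Rn N → ℝ) (G : H0 Ω σ → Rn N → ℝ) (u : H0 Ω σ) : Prop :=
  (u : Lp ℝ 2 (volume : Measure (Rn N))) ∈ constraintSet Ω σ (G u) ∧
  ∀ v ∈ constraintSet Ω σ (G u),
    ∫ x in Ω, f x * (v x - (u : Lp ℝ 2 (volume : Measure (Rn N))) x) ≤
      ∫ x, inner ℝ (Matrix.toEuclideanLin (A x) (sigmaGrad σ u.1 x))
        (sigmaGrad σ (v - u.1) x)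

end SigmaGrad

end

/-! The problem is moved to a Hilbert space of gradients and solved there by a contraction.

Scaling. Because `G[u] = φ Γ(u)`, the convex sets are dilates of one another: with `K_t = {|D^σ v| ≤
t φ}` one has `s K_t = K_{st}` for `s, t > 0`. If `u₁`, `u₂` solve the variational inequality with
datum `f` over `K_{t₁}`, `K_{t₂}`, then `(t₂/t₁) u₁` solves it over `K_{t₂}` with datum `(t₂/t₁) f`,
and coercivity compares it with `u₂`. Every solution has norm at most `R_f`, so `‖u₁ - u₂‖ ≤ 2 R_f
|t₁ - t₂| / t₁`. Taking `tᵢ = Γ(wᵢ)` with `wᵢ` in the ball of radius `R_f`, the map sending `w` to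
the solution over `K_{Γ(w)}`, which exists by Stampacchia's theorem, contracts that ball with factor
`2 R_f γ / η < 1`. All solutions of the quasi-variational inequality lie in the ball, so the fixed
point is the only one: `existsUnique_isVISolution_gauge`.

Hilbert space. This requires `H^σ_0(Ω)` to be complete for `‖D^σ u‖`. By `exists_gradient_space`,
`D^σ` identifies it with a closed subspace of `L²(ℝ^N)^N`. Two facts carry this: the relation `F =
D^σ u` is closed and linear over functions supported in a fixed ball (`exists_dual_hasSigmaGrad`),
and the fractional Poincaré inequality holds (`exists_integral_sq_le_norm_sq`). The latter is proved
by Fourier analysis: the transform of the Riesz kernel gives `‖D^σ φ‖² = c ∫ |ξ|^{2σ} |φ̂|²`, and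
the low frequencies of a function supported in a bounded set are absorbed by its `L²` norm. -/

namespace SigmaGrad

/-! ### Variational and quasi-variational inequalities in a Hilbert space -/

section Abstract

variable {H : Type*} [NormedAddCommGroup H] [InnerProductSpace ℝ H]

/-- `u` solves the variational inequality for the bilinear form `B`, the functional `ℓ` and the
convex set `K`. -/
def IsVISolution (B : H →L[ℝ] H →L[ℝ] ℝ) (ℓ : H →L[ℝ] ℝ) (K : Set H) (u : H) : Prop :=
  u ∈ K ∧ ∀ v ∈ K, ℓ (v - u) ≤ B u (v - u)

/-- The projection onto a convex set, described by its variational inequality, is nonexpansive. -/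
theorem norm_sub_le_of_projection {x y p q : H}
    (hp : inner ℝ (x - p) (q - p) ≤ 0) (hq : inner ℝ (y - q) (p - q) ≤ 0) :
    ‖p - q‖ ≤ ‖x - y‖ := by
  have h1 : ‖p - q‖ ^ 2 ≤ inner ℝ (x - y) (p - q) := by
    have e : inner ℝ (x - y) (p - q) - ‖p - q‖ ^ 2
        = - inner ℝ (x - p) (q - p) - inner ℝ (y - q) (p - q) := by
      rw [← real_inner_self_eq_norm_sq]
      simp only [inner_sub_left, inner_sub_right, real_inner_comm]
      ring
    linarith
  have h2 := real_inner_le_norm (x - y) (p - q)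
  by_contra! h
  have h0 : 0 ≤ ‖x - y‖ := norm_nonneg _
  nlinarith

/-- A coercive bilinear form gives continuous dependence of the solution on the functional. -/
theorem IsVISolution.norm_sub_le {B : H →L[ℝ] H →L[ℝ] ℝ} {a : ℝ} (ha : 0 < a)
    (hB : ∀ u, a * ‖u‖ ^ 2 ≤ B u u) {ℓ₁ ℓ₂ : H →L[ℝ] ℝ} {K : Set H} {u₁ u₂ : H} {m : ℝ}
    (h₁ : IsVISolution B ℓ₁ K u₁) (h₂ : IsVISolution B ℓ₂ K u₂) (hm0 : 0 ≤ m)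
    (hm : ∀ v, |ℓ₁ v - ℓ₂ v| ≤ m * ‖v‖) : ‖u₁ - u₂‖ ≤ m / a := by
  -- Testing each inequality with the other solution and adding gives `a ‖u₁ - u₂‖² ≤ B (u₁ - u₂)
  -- (u₁ - u₂) ≤ (ℓ₁ - ℓ₂) (u₁ - u₂) ≤ m ‖u₁ - u₂‖`.
  have e1 := h₁.2 u₂ h₂.1
  have e2 := h₂.2 u₁ h₁.1
  have e3 := hB (u₁ - u₂)
  have e4 := (le_abs_self _).trans (hm (u₁ - u₂))
  simp only [map_sub, sub_apply] at e1 e2 e3 e4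
  rw [le_div_iff₀ ha]
  by_contra! h
  have hpos : 0 < ‖u₁ - u₂‖ := by
    by_contra! h'
    have : ‖u₁ - u₂‖ = 0 := le_antisymm h' (norm_nonneg _)
    rw [this] at h
    linarith
  nlinarith

/-- Stampacchia's theorem. -/
theorem exists_isVISolution [CompleteSpace H] (B : H →L[ℝ] H →L[ℝ] ℝ) {a : ℝ} (ha : 0 < a)
    (hB : ∀ u, a * ‖u‖ ^ 2 ≤ B u u) (ℓ : H →L[ℝ] ℝ) {K : Set H} (hne : K.Nonempty)
    (hcl : IsClosed K) (hcv : Convex ℝ K) : ∃ u, IsVISolution B ℓ K u := by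
  have hproj : ∀ x : H, ∃ p ∈ K, ∀ w ∈ K, inner ℝ (x - p) (w - p) ≤ 0 := by
    intro x
    obtain ⟨p, hp, h⟩ := exists_norm_eq_iInf_of_complete_convex hne hcl.isComplete hcv x
    exact ⟨p, hp, (norm_eq_iInf_iff_real_inner_le_zero hcv hp).1 h⟩
  choose P hPK hP using hproj
  set T := InnerProductSpace.continuousLinearMapOfBilin (𝕜 := ℝ) B with hT
  have hTB : ∀ u v, inner ℝ (T u) v = B u v :=
    fun u v => InnerProductSpace.continuousLinearMapOfBilin_apply B u v
  set b := (InnerProductSpace.toDual ℝ H).symm ℓ with hb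
  have hbl : ∀ v, inner ℝ b v = ℓ v := fun v => InnerProductSpace.toDual_symm_apply
  -- Adding `a` to the operator norm keeps `Λ` positive and `a ≤ Λ`. The step `ρ = a / Λ²` minimises
  -- `1 - 2ρa + ρ²Λ²`, with minimum `1 - a²/Λ²`.
  set Λ := ‖T‖ + a with hΛ
  have hΛ0 : 0 < Λ := by positivity
  have haΛ : a ≤ Λ := by have := norm_nonneg T; linarith
  set ρ := a / Λ ^ 2 with hρ
  have hρ0 : 0 < ρ := by positivity
  have hk0 : 0 ≤ 1 - a ^ 2 / Λ ^ 2 := by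
    rw [sub_nonneg, div_le_one (by positivity)]
    gcongr
  have hk1 : Real.sqrt (1 - a ^ 2 / Λ ^ 2) < 1 := by
    rw [Real.sqrt_lt' one_pos]
    have : 0 < a ^ 2 / Λ ^ 2 := by positivity
    linarith
  have hcontr : ∀ w : H, ‖w - ρ • T w‖ ≤ Real.sqrt (1 - a ^ 2 / Λ ^ 2) * ‖w‖ := by
    intro w
    have h1 : ‖w - ρ • T w‖ ^ 2 ≤ (1 - a ^ 2 / Λ ^ 2) * ‖w‖ ^ 2 := by
      have e : ‖w - ρ • T w‖ ^ 2 = ‖w‖ ^ 2 - 2 * (ρ * B w w) + ρ ^ 2 * ‖T w‖ ^ 2 := by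
        rw [norm_sub_sq_real, inner_smul_right, norm_smul, real_inner_comm, hTB, mul_pow,
          Real.norm_eq_abs, sq_abs]
      have h2 : ‖T w‖ ≤ Λ * ‖w‖ :=
        (T.le_opNorm w).trans (by gcongr; rw [hΛ]; linarith)
      have h3 : ‖T w‖ ^ 2 ≤ Λ ^ 2 * ‖w‖ ^ 2 := by
        rw [← mul_pow]
        gcongr
      have h4 : ρ ^ 2 * ‖T w‖ ^ 2 ≤ ρ ^ 2 * (Λ ^ 2 * ‖w‖ ^ 2) := by gcongr
      have h5 : ρ * (a * ‖w‖ ^ 2) ≤ ρ * B w w := by gcongr; exact hB w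
      have h6 : ρ ^ 2 * (Λ ^ 2 * ‖w‖ ^ 2) = a ^ 2 / Λ ^ 2 * ‖w‖ ^ 2 := by
        rw [hρ]; field_simp
      have h7 : ρ * (a * ‖w‖ ^ 2) = a ^ 2 / Λ ^ 2 * ‖w‖ ^ 2 := by
        rw [hρ]; field_simp
      rw [e]
      linarith
    rw [← Real.sqrt_sq (norm_nonneg w), ← Real.sqrt_mul hk0]
    exact Real.le_sqrt_of_sq_le h1
  -- For `ρ > 0`, the equation `u = P (u - ρ (T u - b))` is the variational inequality: the
  -- projection characterisation reads `-ρ ⟪T u - b, v - u⟫ ≤ 0` on `K`.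
  let S : H → H := fun u => P (u - ρ • (T u - b))
  have hS : ContractingWith ⟨Real.sqrt (1 - a ^ 2 / Λ ^ 2), Real.sqrt_nonneg _⟩ S := by
    refine ⟨hk1, LipschitzWith.of_dist_le_mul fun u v => ?_⟩
    rw [dist_eq_norm, dist_eq_norm]
    refine (norm_sub_le_of_projection (hP _ _ (hPK _)) (hP _ _ (hPK _))).trans ?_
    have : u - ρ • (T u - b) - (v - ρ • (T v - b)) = (u - v) - ρ • T (u - v) := by
      rw [map_sub]; module
    rw [this]
    exact hcontr _
  have hfix : S (hS.fixedPoint S) = hS.fixedPoint S := hS.fixedPoint_isFixedPt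
  set u := hS.fixedPoint S
  refine ⟨u, by rw [← hfix]; exact hPK _, fun v hv => ?_⟩
  have h1 := hP (u - ρ • (T u - b)) v hv
  change inner ℝ (u - ρ • (T u - b) - S u) (v - S u) ≤ 0 at h1
  rw [hfix] at h1
  have h2 : u - ρ • (T u - b) - u = -(ρ • (T u - b)) := by abel
  rw [h2, inner_neg_left, real_inner_smul_left, inner_sub_left, hTB, hbl] at h1
  have h3 : 0 ≤ ρ * (B u (v - u) - ℓ (v - u)) := by linarith
  have := nonneg_of_mul_nonneg_right h3 hρ0
  linarith

/-- Rescaling a solution with a gauge family of convex sets. -/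
theorem IsVISolution.smul {B : H →L[ℝ] H →L[ℝ] ℝ} {ℓ : H →L[ℝ] ℝ} {K : ℝ → Set H}
    (hsmul : ∀ s t : ℝ, 0 < s → 0 < t → ∀ v ∈ K t, s • v ∈ K (s * t)) {t s : ℝ} (ht : 0 < t)
    (hs : 0 < s) {u : H} (hu : IsVISolution B ℓ (K t) u) :
    IsVISolution B (s • ℓ) (K (s * t)) (s • u) := by
  refine ⟨hsmul s t hs ht u hu.1, fun v hv => ?_⟩
  -- A competitor for the dilated set is shrunk by `s⁻¹` to become one for `K t`; both sides of the
  -- inequality then scale by `s²`.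
  have h1 := hsmul s⁻¹ (s * t) (by positivity) (by positivity) v hv
  rw [inv_mul_cancel_left₀ hs.ne'] at h1
  have h2 := hu.2 _ h1
  have h3 : v - s • u = s • (s⁻¹ • v - u) := by
    rw [smul_sub, smul_inv_smul₀ hs.ne']
  rw [h3]
  simp only [map_smul, smul_apply, smul_eq_mul]
  have : s * (s * ℓ (s⁻¹ • v - u)) ≤ s * (s * B u (s⁻¹ • v - u)) := by gcongr
  linarith

/-- Existence and uniqueness for a quasi-variational inequality whose convex set depends on the
solution through a positive factor. -/
theorem existsUnique_isVISolution_gauge [CompleteSpace H] (B : H →L[ℝ] H →L[ℝ] ℝ) {a : ℝ}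
    (ha : 0 < a) (hB : ∀ u, a * ‖u‖ ^ 2 ≤ B u u) (ℓ : H →L[ℝ] ℝ) {r : ℝ} (hr : 0 ≤ r)
    (hℓ : ∀ v, |ℓ v| ≤ a * r * ‖v‖) {K : ℝ → Set H} (hK0 : ∀ t, 0 < t → (0 : H) ∈ K t)
    (hcl : ∀ t, 0 < t → IsClosed (K t)) (hcv : ∀ t, 0 < t → Convex ℝ (K t))
    (hsmul : ∀ s t : ℝ, 0 < s → 0 < t → ∀ v ∈ K t, s • v ∈ K (s * t))
    (Γ : H → ℝ) (hΓ : ∀ u, 0 < Γ u) {c d : ℝ} (hc : 0 < c) (hd : 0 ≤ d)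
    (hΓc : ∀ u, ‖u‖ ≤ r → c ≤ Γ u)
    (hΓd : ∀ u v, ‖u‖ ≤ r → ‖v‖ ≤ r → |Γ u - Γ v| ≤ d * ‖u - v‖)
    (hsmall : 2 * r * (d / c) < 1) :
    ∃! u, IsVISolution B ℓ (K (Γ u)) u := by
  -- A priori bound independent of `t`: compare with `0`, which solves the inequality with zero
  -- functional over the same set.
  have hbound : ∀ t u, 0 < t → IsVISolution B ℓ (K t) u → ‖u‖ ≤ r := by
    intro t u ht hu
    have h0 : IsVISolution B 0 (K t) 0 := ⟨hK0 t ht, fun v _ => by simp⟩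
    have := hu.norm_sub_le ha hB h0 (m := a * r) (by positivity) (fun v => by simpa using hℓ v)
    rwa [sub_zero, mul_div_cancel_left₀ _ ha.ne'] at this
  -- Passing through `(t₂/t₁) u₁` costs `r |t₁ - t₂| / t₁` twice: once for moving `u₁` to its
  -- dilate, once for the change of functional from `(t₂/t₁) ℓ` to `ℓ`. Hence the factor 2.
  have hdep : ∀ t₁ t₂ u₁ u₂, 0 < t₁ → 0 < t₂ → IsVISolution B ℓ (K t₁) u₁ →
      IsVISolution B ℓ (K t₂) u₂ → ‖u₁ - u₂‖ ≤ 2 * r * (|t₁ - t₂| / t₁) := by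
    intro t₁ t₂ u₁ u₂ ht₁ ht₂ h₁ h₂
    have hs : 0 < t₂ / t₁ := by positivity
    have h₃ := h₁.smul hsmul ht₁ hs
    rw [div_mul_cancel₀ _ ht₁.ne'] at h₃
    have habs : |t₂ / t₁ - 1| = |t₁ - t₂| / t₁ := by
      rw [div_sub_one ht₁.ne', abs_div, abs_of_pos ht₁, abs_sub_comm]
    have e1 := h₃.norm_sub_le ha hB h₂ (m := |t₁ - t₂| / t₁ * (a * r)) (by positivity)
      (fun v => by
        rw [smul_apply, smul_eq_mul, ← sub_one_mul, abs_mul, habs, mul_assoc]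
        gcongr
        exact hℓ v)
    have e2 : ‖u₁ - (t₂ / t₁) • u₁‖ ≤ |t₁ - t₂| / t₁ * r := by
      have : u₁ - (t₂ / t₁) • u₁ = -((t₂ / t₁ - 1) • u₁) := by module
      rw [this, norm_neg, norm_smul, Real.norm_eq_abs, habs]
      gcongr
      exact hbound t₁ u₁ ht₁ h₁
    have e3 : |t₁ - t₂| / t₁ * (a * r) / a = |t₁ - t₂| / t₁ * r := by field_simp
    have e4 := norm_sub_le_norm_sub_add_norm_sub u₁ ((t₂ / t₁) • u₁) u₂
    rw [e3] at e1
    linarith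
  have hex : ∀ w, ∃ u, IsVISolution B ℓ (K (Γ w)) u := fun w =>
    exists_isVISolution B ha hB ℓ ⟨0, hK0 _ (hΓ w)⟩ (hcl _ (hΓ w)) (hcv _ (hΓ w))
  choose S hS using hex
  have hSball : ∀ w, ‖S w‖ ≤ r := fun w => hbound _ _ (hΓ w) (hS w)
  have hlip : ∀ w₁ w₂ u₁ u₂, ‖w₁‖ ≤ r → ‖w₂‖ ≤ r → IsVISolution B ℓ (K (Γ w₁)) u₁ →
      IsVISolution B ℓ (K (Γ w₂)) u₂ → ‖u₁ - u₂‖ ≤ 2 * r * (d / c) * ‖w₁ - w₂‖ := by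
    intro w₁ w₂ u₁ u₂ h₁ h₂ hu₁ hu₂
    refine (hdep _ _ _ _ (hΓ w₁) (hΓ w₂) hu₁ hu₂).trans ?_
    rw [mul_assoc (2 * r), div_mul_eq_mul_div]
    gcongr
    · exact hΓd w₁ w₂ h₁ h₂
    · exact hΓc w₁ h₁
  have hmaps : Set.MapsTo S (Metric.closedBall 0 r) (Metric.closedBall 0 r) := fun w _ => by
    simpa using hSball w
  have hcontr : ContractingWith ⟨2 * r * (d / c), by positivity⟩ (hmaps.restrict S _ _) := by
    refine ⟨hsmall, LipschitzWith.of_dist_le_mul fun u v => ?_⟩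
    rw [Subtype.dist_eq, Subtype.dist_eq, dist_eq_norm, dist_eq_norm]
    exact hlip u v _ _ (mem_closedBall_zero_iff.1 u.2) (mem_closedBall_zero_iff.1 v.2) (hS _) (hS _)
  obtain ⟨u, -, hu, -⟩ := ContractingWith.exists_fixedPoint' Metric.isClosed_closedBall.isComplete hmaps hcontr
    (x := 0) (Metric.mem_closedBall_self hr) (edist_ne_top _ _)
  have huS := hS u
  rw [show S u = u from hu] at huS
  refine ⟨u, huS, fun v hv => ?_⟩
  -- Uniqueness is global, not only in the ball, since `hbound` puts any solution in the ball.
  have h := hlip v u v u (hbound _ _ (hΓ v) hv) (hbound _ _ (hΓ u) huS) hv huS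
  have h0 : ‖v - u‖ = 0 := by
    by_contra hne
    have : 0 < ‖v - u‖ := lt_of_le_of_ne (norm_nonneg _) (Ne.symm hne)
    nlinarith
  exact sub_eq_zero.1 (norm_eq_zero.1 h0)

end Abstract

end SigmaGrad

namespace SigmaGrad

open MeasureTheory

/-! ### Integrability and Fubini identities for the Riesz kernel -/

section Kernel

variable {N : ℕ}

theorem integrableOn_ball_norm_rpow_neg (hN : 1 ≤ N) {β : ℝ} (hβN : β < N) :
    IntegrableOn (fun z : Rn N => ‖z‖ ^ (-β)) (Metric.ball 0 1) := by
  refine integrableOn_ball_of_norm_le_rpow (C := 1) (α := β) (by simpa using hN)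
    (by simpa using hβN) (Filter.Eventually.of_forall fun x => ?_)
    (Measurable.aestronglyMeasurable (by fun_prop))
  rw [one_mul, Real.norm_of_nonneg (by positivity)]

/-- A function dominated near the origin by the kernel, and by `‖w‖` away from it. -/
theorem norm_rpow_neg_mul_le {β : ℝ} (hβ0 : 0 ≤ β) {C a : ℝ} (ha : 0 ≤ a) (haC : a ≤ C)
    (z : Rn N) :
    ‖z‖ ^ (-β) * a ≤ C * (Metric.ball (0 : Rn N) 1).indicator (fun z => ‖z‖ ^ (-β)) z + a := by
  by_cases hz : z ∈ Metric.ball (0 : Rn N) 1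
  · rw [Set.indicator_of_mem hz, mul_comm C]
    have : ‖z‖ ^ (-β) * a ≤ ‖z‖ ^ (-β) * C := by gcongr
    linarith
  · rw [Set.indicator_of_notMem hz, mul_zero, zero_add]
    have h1 : 1 ≤ ‖z‖ := by simpa using hz
    have := Real.rpow_le_one_of_one_le_of_nonpos h1 (neg_nonpos.2 hβ0)
    exact mul_le_of_le_one_left ha this

theorem integrable_norm_rpow_neg_smul {F : Type*} [NormedAddCommGroup F] [NormedSpace ℝ F]
    (hN : 1 ≤ N) {β : ℝ} (hβ0 : 0 ≤ β) (hβN : β < N) {g : Rn N → F} (hg : Integrable g) {C : ℝ}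
    (hC : ∀ z, ‖g z‖ ≤ C) : Integrable (fun z => ‖z‖ ^ (-β) • g z) := by
  have h1 : Integrable ((Metric.ball (0 : Rn N) 1).indicator (fun z => ‖z‖ ^ (-β))) :=
    (integrable_indicator_iff measurableSet_ball).2 (integrableOn_ball_norm_rpow_neg hN hβN)
  have hm : Measurable (fun z : Rn N => ‖z‖ ^ (-β)) := by fun_prop
  refine ((h1.const_mul C).add hg.norm).mono' (hm.aestronglyMeasurable.smul hg.1)
    (Filter.Eventually.of_forall fun z => ?_)
  rw [norm_smul, Real.norm_of_nonneg (by positivity)]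
  exact norm_rpow_neg_mul_le hβ0 (norm_nonneg _) (hC z) z

theorem integrable_norm_sub_rpow_neg_mul (hN : 1 ≤ N) {β : ℝ} (hβ0 : 0 ≤ β) (hβN : β < N)
    {w : Rn N → ℝ} (hw : Integrable w) {C : ℝ} (hC : ∀ z, ‖w z‖ ≤ C) (y : Rn N) :
    Integrable (fun x => ‖x - y‖ ^ (-β) * w x) := by
  have h := (integrable_norm_rpow_neg_smul hN hβ0 hβN (hw.comp_add_right y)
    (fun z => hC (z + y))).comp_sub_right y
  simpa using h

/-- The bound is uniform in `y` because the singular part is dominated by a translate of a fixed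
integrable function. This makes the Riesz potential of a bounded integrable function bounded. -/
theorem exists_integral_norm_sub_rpow_neg_mul_le (hN : 1 ≤ N) {β : ℝ} (hβ0 : 0 ≤ β)
    (hβN : β < N) {w : Rn N → ℝ} (hw : Integrable w) {C : ℝ} (hC : ∀ z, ‖w z‖ ≤ C) :
    ∃ M, 0 ≤ M ∧ ∀ y, ∫ x, ‖x - y‖ ^ (-β) * ‖w x‖ ≤ M := by
  have h1 : Integrable ((Metric.ball (0 : Rn N) 1).indicator (fun z => ‖z‖ ^ (-β))) :=
    (integrable_indicator_iff measurableSet_ball).2 (integrableOn_ball_norm_rpow_neg hN hβN)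
  have hC0 : 0 ≤ C := (norm_nonneg _).trans (hC 0)
  refine ⟨C * (∫ z, (Metric.ball (0 : Rn N) 1).indicator (fun z => ‖z‖ ^ (-β)) z) + ∫ x, ‖w x‖,
    ?_, fun y => ?_⟩
  · have : 0 ≤ ∫ z, (Metric.ball (0 : Rn N) 1).indicator (fun z => ‖z‖ ^ (-β)) z :=
      integral_nonneg fun z => Set.indicator_nonneg (fun z _ => by positivity) z
    positivity
  · have h2 := ((h1.comp_sub_right y).const_mul C)
    calc ∫ x, ‖x - y‖ ^ (-β) * ‖w x‖
        ≤ ∫ x, (C * (Metric.ball (0 : Rn N) 1).indicator (fun z => ‖z‖ ^ (-β)) (x - y)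
            + ‖w x‖) := by
          refine integral_mono (integrable_norm_sub_rpow_neg_mul hN hβ0 hβN hw.norm
            (fun z => by simpa using hC z) y) (h2.add hw.norm) fun x => ?_
          exact norm_rpow_neg_mul_le hβ0 (norm_nonneg _) (hC x) (x - y)
      _ = _ := by
          rw [integral_add h2 hw.norm, integral_const_mul,
            integral_sub_right_eq_self (fun z =>
              (Metric.ball (0 : Rn N) 1).indicator (fun z => ‖z‖ ^ (-β)) z)]

theorem integrable_prod_riesz (hN : 1 ≤ N) {β : ℝ} (hβ0 : 0 ≤ β) (hβN : β < N)
    {u w : Rn N → ℝ} (hu : Integrable u) (hw : Integrable w) {C : ℝ} (hC : ∀ z, ‖w z‖ ≤ C) :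
    Integrable (fun p : Rn N × Rn N => ‖p.1 - p.2‖ ^ (-β) * (w p.1 * u p.2))
      (volume.prod volume) := by
  have hm : Measurable (fun p : Rn N × Rn N => ‖p.1 - p.2‖ ^ (-β)) := by fun_prop
  have hmeas : AEStronglyMeasurable (fun p : Rn N × Rn N => ‖p.1 - p.2‖ ^ (-β) * (w p.1 * u p.2))
      (volume.prod volume) :=
    hm.aestronglyMeasurable.mul (hw.1.comp_fst.mul hu.1.comp_snd)
  obtain ⟨M, hM0, hM⟩ := exists_integral_norm_sub_rpow_neg_mul_le hN hβ0 hβN hw hC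
  rw [integrable_prod_iff' hmeas]
  constructor
  · refine Filter.Eventually.of_forall fun y => ?_
    simpa [mul_assoc] using (integrable_norm_sub_rpow_neg_mul hN hβ0 hβN hw hC y).mul_const (u y)
  · refine (hu.norm.const_mul M).mono' hmeas.norm.prod_swap.integral_prod_right'
      (Filter.Eventually.of_forall fun y => ?_)
    have e : ∀ x, ‖‖x - y‖ ^ (-β) * (w x * u y)‖ = ‖x - y‖ ^ (-β) * ‖w x‖ * ‖u y‖ := fun x => by
      rw [norm_mul, norm_mul, Real.norm_of_nonneg (by positivity : 0 ≤ ‖x - y‖ ^ (-β)), mul_assoc]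
    simp only [e]
    rw [integral_mul_const, Real.norm_of_nonneg]
    · gcongr
      exact hM y
    · exact mul_nonneg (integral_nonneg fun x => by positivity) (norm_nonneg _)

/-- The Riesz kernel is symmetric. -/
theorem integral_riesz_mul_comm (hN : 1 ≤ N) {β : ℝ} (hβ0 : 0 ≤ β) (hβN : β < N)
    {u w : Rn N → ℝ} (hu : Integrable u) (hw : Integrable w) {C : ℝ} (hC : ∀ z, ‖w z‖ ≤ C) :
    ∫ x, (∫ y, u y / ‖x - y‖ ^ β) * w x = ∫ y, u y * ∫ x, ‖x - y‖ ^ (-β) * w x := by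
  have h := integral_integral_swap
    (f := fun x y => ‖x - y‖ ^ (-β) * (w x * u y)) (integrable_prod_riesz hN hβ0 hβN hu hw hC)
  simp only [← integral_mul_const, ← integral_const_mul]
  refine Eq.trans ?_ (h.trans ?_)
  · refine integral_congr_ae (Filter.Eventually.of_forall fun x => integral_congr_ae
      (Filter.Eventually.of_forall fun y => ?_))
    simp only [Real.rpow_neg (norm_nonneg _)]
    ring
  · refine integral_congr_ae (Filter.Eventually.of_forall fun x => integral_congr_ae
      (Filter.Eventually.of_forall fun y => ?_))
    ring

/-- The pairing of a Riesz potential with a function, through the cross-correlation. -/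
theorem integral_riesz_mul_eq (hN : 1 ≤ N) {β : ℝ} (hβ0 : 0 ≤ β) (hβN : β < N)
    {u w : Rn N → ℝ} (hu : Integrable u) (hw : Integrable w) {C : ℝ} (hC : ∀ z, ‖w z‖ ≤ C) :
    ∫ x, (∫ y, u y / ‖x - y‖ ^ β) * w x = ∫ z, ‖z‖ ^ (-β) * ∫ x, w x * u (x - z) := by
  have hI := integrable_prod_riesz hN hβ0 hβN hu hw hC
  -- The shear `(x, z) ↦ (x, x - z)` substitutes `y = x - z` and turns the kernel into a function of
  -- `z` alone.
  have hmp : MeasurePreserving (fun p : Rn N × Rn N => (p.1, p.1 - p.2))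
      (volume.prod volume) (volume.prod volume) :=
    MeasurePreserving.skew_product (g := fun x z => x - z) (MeasurePreserving.id _)
      (by fun_prop)
      (Filter.Eventually.of_forall fun x => (Measure.measurePreserving_sub_left volume x).map_eq)
  have hI' : Integrable (fun p : Rn N × Rn N => ‖p.2‖ ^ (-β) * (w p.1 * u (p.1 - p.2)))
      (volume.prod volume) := by
    have := hmp.integrable_comp_of_integrable hI
    simpa [Function.comp_def] using this
  have h := integral_integral_swap
    (f := fun x z => ‖z‖ ^ (-β) * (w x * u (x - z))) hI'
  simp only [← integral_mul_const, ← integral_const_mul]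
  refine Eq.trans ?_ h
  refine integral_congr_ae (Filter.Eventually.of_forall fun x => ?_)
  simp only
  rw [← integral_sub_left_eq_self _ volume x]
  refine integral_congr_ae (Filter.Eventually.of_forall fun y => ?_)
  simp only [sub_sub_cancel, Real.rpow_neg (norm_nonneg _)]
  ring

end Kernel

end SigmaGrad

namespace SigmaGrad

open MeasureTheory
open scoped SchwartzMap FourierTransform

/-! ### Fourier transform of the Riesz kernel by superposition of Gaussians -/

section RieszFourier

/-- Fubini for a positive superposition `m(z) = ∫₀^∞ k(t, z) dt` of kernels. -/
theorem integral_superposition_smul {V F : Type*} [MeasurableSpace V] {μ : Measure V} [SFinite μ]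
    [NormedAddCommGroup F] [NormedSpace ℝ F] [CompleteSpace F] {k : ℝ → V → ℝ}
    (hk : Measurable (Function.uncurry k)) (hk0 : ∀ t, 0 < t → ∀ z, 0 ≤ k t z) {m : V → ℝ}
    (hm : ∀ᵐ z ∂μ, IntegrableOn (fun t => k t z) (Set.Ioi 0) ∧ ∫ t in Set.Ioi 0, k t z = m z)
    {g : V → F} (hg : AEStronglyMeasurable g μ) (hmg : Integrable (fun z => m z • g z) μ) :
    ∫ t in Set.Ioi 0, ∫ z, k t z • g z ∂μ = ∫ z, m z • g z ∂μ := by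
  have hmeas : AEStronglyMeasurable (fun p : ℝ × V => k p.1 p.2 • g p.2)
      ((volume.restrict (Set.Ioi 0)).prod μ) :=
    hk.aestronglyMeasurable.smul hg.comp_snd
  have hI : Integrable (fun p : ℝ × V => k p.1 p.2 • g p.2)
      ((volume.restrict (Set.Ioi 0)).prod μ) := by
    rw [integrable_prod_iff' hmeas]
    constructor
    · filter_upwards [hm] with z hz
      exact Integrable.smul_const hz.1 (g z)
    · refine hmg.norm.congr ?_
      filter_upwards [hm] with z hz
      have e : ∫ t in Set.Ioi 0, ‖k t z • g z‖ = ∫ t in Set.Ioi 0, k t z * ‖g z‖ := by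
        refine setIntegral_congr_fun measurableSet_Ioi fun t ht => ?_
        simp only [norm_smul]
        rw [Real.norm_of_nonneg (hk0 t ht z)]
      have h0 : 0 ≤ m z := by
        rw [← hz.2]
        exact setIntegral_nonneg measurableSet_Ioi fun t ht => hk0 t ht z
      rw [e, integral_mul_const, hz.2, norm_smul, Real.norm_of_nonneg h0]
  rw [integral_integral_swap (f := fun t z => k t z • g z) hI]
  refine integral_congr_ae ?_
  filter_upwards [hm] with z hz
  rw [integral_smul_const, hz.2]

/-- The substitution `t ↦ 1/t` reduces this to Euler's integral. -/
theorem integral_rpow_mul_exp_neg_div_Ioi {s b : ℝ} (hs : 0 < s) (hb : 0 < b) :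
    ∫ t in Set.Ioi 0, t ^ (-s - 1) * Real.exp (-(b / t)) = (1 / b) ^ s * Real.Gamma s := by
  rw [← Real.integral_rpow_mul_exp_neg_mul_Ioi hs hb,
    ← integral_comp_rpow_Ioi (fun t => t ^ (s - 1) * Real.exp (-(b * t)))
      (by norm_num : (-1 : ℝ) ≠ 0)]
  refine setIntegral_congr_fun measurableSet_Ioi fun t (ht : 0 < t) => ?_
  simp only [abs_neg, abs_one, one_mul, smul_eq_mul]
  rw [← Real.rpow_mul ht.le, ← mul_assoc, ← Real.rpow_add ht, Real.rpow_neg_one, div_eq_mul_inv]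
  ring_nf

variable {N : ℕ}

/-- The multiplication formula `∫ f ĝ = ∫ f̂ g`, with `f` a Gaussian. -/
theorem integral_gaussian_mul_schwartz {t : ℝ} (ht : 0 < t) (g : 𝓢(Rn N, ℂ)) :
    ∫ z, Real.exp (-(t * ‖z‖ ^ 2)) • 𝓕 g z =
      (Real.pi / t) ^ ((N : ℝ) / 2) •
        ∫ ξ, Real.exp (-(Real.pi ^ 2 * ‖ξ‖ ^ 2 / t)) • g ξ := by
  have hG : Integrable (fun v : Rn N => Complex.exp (-(t : ℂ) * ‖v‖ ^ 2)) := by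
    simpa using GaussianFourier.integrable_cexp_neg_mul_sq_norm_add (V := Rn N)
      (b := (t : ℂ)) (by simpa using ht) 0 0
  have h := VectorFourier.integral_fourierIntegral_smul_eq_flip (L := innerₗ (Rn N))
    (e := Real.fourierChar) (μ := volume) (ν := volume) Real.continuous_fourierChar
    continuous_inner hG (g.integrable)
  have e1 : VectorFourier.fourierIntegral Real.fourierChar volume (innerₗ (Rn N))
      (fun v : Rn N => Complex.exp (-(t : ℂ) * ‖v‖ ^ 2)) = fun ξ =>
        (((Real.pi / t) ^ ((N : ℝ) / 2) : ℝ) : ℂ) *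
          Complex.exp ((-(Real.pi ^ 2 * ‖ξ‖ ^ 2 / t) : ℝ) : ℂ) := by
    funext ξ
    have := fourier_gaussian_innerProductSpace (V := Rn N) (b := (t : ℂ)) (by simpa using ht) ξ
    refine (show _ = _ from this).trans ?_
    rw [Complex.ofReal_cpow (by positivity)]
    push_cast
    simp only [finrank_euclideanSpace, Fintype.card_fin]
    congr 2
    ring
  have e2 : VectorFourier.fourierIntegral Real.fourierChar volume (innerₗ (Rn N)).flip
      (g : Rn N → ℂ) = 𝓕 g := by
    rw [flip_innerₗ]; rfl
  rw [e1, e2] at h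
  rw [← integral_smul]
  refine Eq.trans ?_ (h.symm.trans ?_)
  · refine integral_congr_ae (Filter.Eventually.of_forall fun z => ?_)
    simp [Complex.real_smul]
  · refine integral_congr_ae (Filter.Eventually.of_forall fun z => ?_)
    simp [Complex.real_smul, mul_assoc]

theorem schwartz_norm_le (g : 𝓢(Rn N, ℂ)) : ∃ C, ∀ z, ‖g z‖ ≤ C := by
  obtain ⟨C, hC⟩ := g.decay 0 0
  exact ⟨C, fun z => by simpa using hC.2 z⟩

theorem ae_norm_pos (hN : 1 ≤ N) : ∀ᵐ z : Rn N, 0 < ‖z‖ := by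
  have : Nonempty (Fin N) := ⟨⟨0, hN⟩⟩
  filter_upwards [Measure.ae_ne volume (0 : Rn N)] with z hz
  exact norm_pos_iff.2 hz

/-- The Fourier transform of the Riesz kernel. -/
theorem exists_integral_riesz_eq_fourier (hN : 1 ≤ N) {α : ℝ} (hα0 : 0 < α) (hαN : α < N) :
    ∃ C : ℝ, 0 < C ∧ ∀ g : 𝓢(Rn N, ℂ),
      ∫ z, ‖z‖ ^ (-((N : ℝ) - α)) • g z = C • ∫ ξ, ‖ξ‖ ^ (-α) • 𝓕 g ξ := by
  set s : ℝ := ((N : ℝ) - α) / 2 with hs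
  have hs0 : 0 < s := by rw [hs]; linarith
  have hpi := Real.pi_pos
  have hΓ1 := Real.Gamma_pos_of_pos hs0
  have hΓ2 := Real.Gamma_pos_of_pos (half_pos hα0)
  refine ⟨Real.Gamma (α / 2) / (Real.pi ^ ((N : ℝ) / 2) * (Real.pi ^ (-((N : ℝ) - α)) *
    Real.Gamma s)), by positivity, fun g => ?_⟩
  obtain ⟨Cg, hCg⟩ := schwartz_norm_le g
  obtain ⟨Cf, hCf⟩ := schwartz_norm_le (𝓕 g)
  -- Both kernels `‖z‖^(-α)` and `‖z‖^(-(N-α))` are integrals over `t` of Gaussians, of the two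
  -- types exchanged by the Fourier transform. The Gaussian identity is therefore integrated in `t`,
  -- with the powers matched by `α/2 - 1 - N/2 = -s - 1`.
  have hleft : ∫ t in Set.Ioi (0 : ℝ), ∫ z : Rn N,
      (t ^ (α / 2 - 1) * Real.exp (-(t * ‖z‖ ^ 2))) • 𝓕 g z =
      ∫ z, (Real.Gamma (α / 2) * ‖z‖ ^ (-α)) • 𝓕 g z := by
    refine integral_superposition_smul (by fun_prop) (fun t ht z => by positivity) ?_
      (𝓕 g).integrable.1 ?_
    · filter_upwards [ae_norm_pos hN] with z hz
      have e : ∫ t in Set.Ioi 0, t ^ (α / 2 - 1) * Real.exp (-(t * ‖z‖ ^ 2)) =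
          Real.Gamma (α / 2) * ‖z‖ ^ (-α) := by
        have := Real.integral_rpow_mul_exp_neg_mul_Ioi (half_pos hα0) (sq_pos_of_pos hz)
        simp only [mul_comm (‖z‖ ^ 2)] at this
        rw [this, mul_comm, one_div, ← Real.rpow_natCast, ← Real.rpow_neg hz.le,
          ← Real.rpow_mul hz.le]
        congr 2
        push_cast; ring
      -- A non-integrable function has integral `0` by convention, so a nonzero value yields
      -- integrability.
      exact ⟨.of_integral_ne_zero (by rw [e]; positivity), e⟩
    · simpa only [mul_smul, Pi.smul_def] using (integrable_norm_rpow_neg_smul hN hα0.le hαN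
        (𝓕 g).integrable hCf).smul (Real.Gamma (α / 2))
  have hright : ∫ t in Set.Ioi (0 : ℝ), ∫ z : Rn N,
      (t ^ (-s - 1) * Real.exp (-(Real.pi ^ 2 * ‖z‖ ^ 2 / t))) • g z =
      ∫ z, (Real.pi ^ (-((N : ℝ) - α)) * Real.Gamma s * ‖z‖ ^ (-((N : ℝ) - α))) • g z := by
    refine integral_superposition_smul (by fun_prop) (fun t ht z => by positivity) ?_
      g.integrable.1 ?_
    · filter_upwards [ae_norm_pos hN] with z hz
      have e : ∫ t in Set.Ioi 0, t ^ (-s - 1) * Real.exp (-(Real.pi ^ 2 * ‖z‖ ^ 2 / t)) =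
          Real.pi ^ (-((N : ℝ) - α)) * Real.Gamma s * ‖z‖ ^ (-((N : ℝ) - α)) := by
        rw [integral_rpow_mul_exp_neg_div_Ioi hs0 (by positivity), one_div, ← mul_pow,
          ← Real.rpow_natCast, ← Real.rpow_neg (by positivity), ← Real.rpow_mul (by positivity),
          Real.mul_rpow hpi.le hz.le]
        have : -((2 : ℕ) : ℝ) * s = -((N : ℝ) - α) := by rw [hs]; push_cast; ring
        rw [this]; ring
      exact ⟨.of_integral_ne_zero (by rw [e]; positivity), e⟩
    · simpa only [mul_smul, Pi.smul_def] using (integrable_norm_rpow_neg_smul hN (by linarith)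
        (by linarith) g.integrable hCg).smul (Real.pi ^ (-((N : ℝ) - α)) * Real.Gamma s)
  have hmid : ∫ t in Set.Ioi (0 : ℝ), ∫ z : Rn N,
      (t ^ (α / 2 - 1) * Real.exp (-(t * ‖z‖ ^ 2))) • 𝓕 g z =
      Real.pi ^ ((N : ℝ) / 2) • ∫ t in Set.Ioi (0 : ℝ), ∫ z : Rn N,
      (t ^ (-s - 1) * Real.exp (-(Real.pi ^ 2 * ‖z‖ ^ 2 / t))) • g z := by
    rw [← integral_smul]
    refine setIntegral_congr_fun measurableSet_Ioi fun t (ht : 0 < t) => ?_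
    simp only [mul_smul, integral_smul]
    rw [integral_gaussian_mul_schwartz ht, smul_smul, smul_smul]
    congr 1
    rw [Real.div_rpow hpi.le ht.le, mul_div_assoc', mul_comm, mul_div_assoc, ← Real.rpow_sub ht]
    congr 2
    rw [hs]; ring
  rw [hleft, hright] at hmid
  simp only [mul_smul, integral_smul] at hmid
  rw [div_eq_inv_mul, mul_smul, hmid, smul_smul, smul_smul, smul_smul]
  rw [show (Real.pi ^ ((N : ℝ) / 2) * (Real.pi ^ (-((N : ℝ) - α)) * Real.Gamma s))⁻¹ *
      (Real.pi ^ ((N : ℝ) / 2)) * Real.pi ^ (-((N : ℝ) - α)) * Real.Gamma s = 1 by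
    field_simp]
  rw [one_smul]

end RieszFourier

end SigmaGrad

namespace SigmaGrad

open MeasureTheory
open scoped SchwartzMap FourierTransform ContDiff ENNReal LineDeriv

/-! ### Plancherel's identity for the Riesz gradient -/

section Poincare

variable {N : ℕ}

theorem norm_lp_two_sq {X F : Type*} [MeasurableSpace X] {μ : Measure X} [NormedAddCommGroup F]
    (f : Lp F 2 μ) : ‖f‖ ^ 2 = ∫ x, ‖f x‖ ^ 2 ∂μ := by
  have h0 : 0 ≤ ∫ x, ‖f x‖ ^ 2 ∂μ := integral_nonneg fun x => by positivity
  rw [Lp.norm_def, (Lp.memLp f).eLpNorm_eq_integral_rpow_norm (by norm_num) (by norm_num)]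
  simp only [ENNReal.toReal_ofNat, Real.rpow_ofNat]
  rw [ENNReal.toReal_ofReal (by positivity), ← Real.rpow_natCast, ← Real.rpow_mul h0]
  norm_num

/-- A real test function as a complex Schwartz function. -/
noncomputable def IsTestFunction.toSchwartz {U : Set (Rn N)} {v : Rn N → ℝ} (hv : IsTestFunction U v) :
    𝓢(Rn N, ℂ) :=
  HasCompactSupport.toSchwartzMap (f := fun x => (v x : ℂ))
    (HasCompactSupport.comp_left (g := fun r : ℝ => (r : ℂ)) hv.2.1 Complex.ofReal_zero)
    (Complex.ofRealCLM.contDiff.comp hv.1)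

theorem IsTestFunction.toSchwartz_apply {U : Set (Rn N)} {v : Rn N → ℝ}
    (hv : IsTestFunction U v) (x : Rn N) : hv.toSchwartz x = v x := rfl

theorem IsTestFunction.univ {U : Set (Rn N)} {v : Rn N → ℝ} (hv : IsTestFunction U v) :
    IsTestFunction Set.univ v := ⟨hv.1, hv.2.1, Set.subset_univ _⟩

theorem IsTestFunction.comp_neg {v : Rn N → ℝ} (hv : IsTestFunction Set.univ v) :
    IsTestFunction Set.univ (fun x => v (-x)) :=
  ⟨hv.1.comp contDiff_neg, hv.2.1.comp_homeomorph (Homeomorph.neg _), Set.subset_univ _⟩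

theorem IsTestFunction.fderiv_apply {v : Rn N → ℝ} (hv : IsTestFunction Set.univ v) (m : Rn N) :
    IsTestFunction Set.univ (fun x => fderiv ℝ v x m) :=
  ⟨(hv.1.fderiv_right (m := ∞) (by simp)).clm_apply contDiff_const,
    hv.2.1.fderiv_apply ℝ m, Set.subset_univ _⟩

theorem IsTestFunction.integrable {U : Set (Rn N)} {v : Rn N → ℝ} (hv : IsTestFunction U v) :
    Integrable v := hv.1.continuous.integrable_of_hasCompactSupport hv.2.1

theorem IsTestFunction.exists_bound {U : Set (Rn N)} {v : Rn N → ℝ} (hv : IsTestFunction U v) :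
    ∃ C, ∀ x, ‖v x‖ ≤ C := hv.1.continuous.bounded_above_of_compact_support hv.2.1

theorem IsTestFunction.toSchwartz_fderiv {v : Rn N → ℝ} (hv : IsTestFunction Set.univ v)
    (m : Rn N) : (hv.fderiv_apply m).toSchwartz = ∂_{m} hv.toSchwartz := by
  ext x
  rw [SchwartzMap.lineDerivOp_apply_eq_fderiv, IsTestFunction.toSchwartz_apply]
  have h : HasFDerivAt (fun y => (v y : ℂ)) (Complex.ofRealCLM ∘L fderiv ℝ v x) x :=
    Complex.ofRealCLM.hasFDerivAt.comp x
      ((hv.1.differentiable (by simp)).differentiableAt.hasFDerivAt)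
  have e : fderiv ℝ (hv.toSchwartz : Rn N → ℂ) x = Complex.ofRealCLM ∘L fderiv ℝ v x := h.fderiv
  rw [e]; rfl

/-- Fourier representation of the pairing of a Riesz potential with a directional derivative. -/
theorem exists_integral_rieszPotential_mul_fderiv (hN : 1 ≤ N) {α : ℝ} (hα0 : 0 < α)
    (hαN : α < N) : ∃ c : ℝ, c ≠ 0 ∧ ∀ (φ v : Rn N → ℝ) (hφ : IsTestFunction Set.univ φ)
      (hv : IsTestFunction Set.univ v) (m : Rn N),
      ((∫ x, rieszPotential α φ x * fderiv ℝ v x m : ℝ) : ℂ) =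
        ∫ ξ, 𝓕 hv.toSchwartz ξ •
          (((c * (inner ℝ ξ m * ‖ξ‖ ^ (-α)) : ℝ) : ℂ) * (Complex.I *
            𝓕 hφ.comp_neg.toSchwartz ξ)) := by
  obtain ⟨C, hC0, hC⟩ := exists_integral_riesz_eq_fourier hN hα0 hαN
  have hr : rieszConst N α ≠ 0 := by
    have h1 := Real.Gamma_pos_of_pos (show 0 < ((N : ℝ) - α) / 2 by linarith)
    have h2 := Real.Gamma_pos_of_pos (half_pos hα0)
    have := Real.pi_pos
    unfold rieszConst
    positivity
  refine ⟨rieszConst N α * C * (2 * Real.pi), by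
    have := Real.pi_pos
    positivity, fun φ v hφ hv m => ?_⟩
  obtain ⟨M, hM⟩ := (hv.fderiv_apply m).exists_bound
  have e1 := integral_riesz_mul_eq hN (β := (N : ℝ) - α) (by linarith) (by linarith)
    hφ.integrable (hv.fderiv_apply m).integrable hM
  have e2 : ∫ x, rieszPotential α φ x * fderiv ℝ v x m = rieszConst N α *
      ∫ z, ‖z‖ ^ (-((N : ℝ) - α)) * ∫ x, fderiv ℝ v x m * φ (x - z) := by
    rw [← e1, ← integral_const_mul]
    simp only [rieszPotential, mul_assoc]
  -- The cross-correlation of `∂_m v` with `φ` is the convolution of `∂_m v` with `φ(-·)`, hence a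
  -- Schwartz function to which the Riesz kernel formula applies. The derivative contributes the
  -- factor `2πi ⟪ξ, m⟫`.
  set G : 𝓢(Rn N, ℂ) := SchwartzMap.convolution (ContinuousLinearMap.mul ℂ ℂ)
    (hv.fderiv_apply m).toSchwartz hφ.comp_neg.toSchwartz with hG
  have hGz : ∀ z, G z = ((∫ x, fderiv ℝ v x m * φ (x - z) : ℝ) : ℂ) := fun z => by
    rw [hG, SchwartzMap.convolution_apply, ← integral_complex_ofReal]
    simp [convolution, IsTestFunction.toSchwartz_apply]
  have hFG : ∀ ξ, 𝓕 G ξ = 2 * Real.pi * Complex.I * inner ℝ ξ m * 𝓕 hv.toSchwartz ξ *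
      𝓕 hφ.comp_neg.toSchwartz ξ := fun ξ => by
    have : (inner ℝ · m : Rn N → ℝ).HasTemperateGrowth := by fun_prop
    rw [hG, SchwartzMap.fourier_convolution, hv.toSchwartz_fderiv, SchwartzMap.pairing_apply_apply,
      SchwartzMap.fourier_lineDerivOp_eq]
    simp [SchwartzMap.smulLeftCLM_apply_apply this]
    left
    ring
  have e3 := hC G
  simp only [hGz, hFG] at e3
  rw [e2, Complex.ofReal_mul, ← integral_complex_ofReal]
  simp only [Complex.real_smul] at e3
  simp only [Complex.ofReal_mul]
  rw [e3, ← mul_assoc, ← integral_const_mul]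
  refine integral_congr_ae (Filter.Eventually.of_forall fun ξ => ?_)
  simp only [smul_eq_mul]
  push_cast
  ring

theorem integrable_one_add_sq_mul_norm_sq (ψ : 𝓢(Rn N, ℂ)) :
    Integrable (fun ξ => (1 + ‖ξ‖ ^ 2) * ‖ψ ξ‖ ^ 2) := by
  obtain ⟨C, hC⟩ := schwartz_norm_le ψ
  have h0 := (ψ.integrable (μ := volume)).norm
  have h2 := ψ.integrable_pow_mul volume 2
  refine ((h0.add h2).const_mul C).mono' (by fun_prop) (Filter.Eventually.of_forall fun ξ => ?_)
  rw [Real.norm_of_nonneg (by positivity)]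
  have : ‖ψ ξ‖ ^ 2 ≤ C * ‖ψ ξ‖ := by
    rw [sq]; gcongr; exact hC ξ
  calc (1 + ‖ξ‖ ^ 2) * ‖ψ ξ‖ ^ 2 ≤ (1 + ‖ξ‖ ^ 2) * (C * ‖ψ ξ‖) := by gcongr
    _ = _ := by simp only [Pi.add_apply]; ring

theorem rpow_le_one_add_sq {s r : ℝ} (hs : 0 ≤ s) (hr0 : 0 ≤ r) (hr : r ≤ 2) :
    s ^ r ≤ 1 + s ^ 2 := by
  rcases le_total s 1 with h | h
  · exact (Real.rpow_le_one hs h hr0).trans (by nlinarith [sq_nonneg s])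
  · have := Real.rpow_le_rpow_of_exponent_le h hr
    rw [Real.rpow_two] at this
    linarith

theorem integrable_rpow_mul_norm_sq {σ : ℝ} (hσ0 : 0 ≤ σ) (hσ1 : σ ≤ 1) (ψ : 𝓢(Rn N, ℂ)) :
    Integrable (fun ξ => ‖ξ‖ ^ (2 * σ) * ‖ψ ξ‖ ^ 2) := by
  have hm : Measurable (fun ξ : Rn N => ‖ξ‖ ^ (2 * σ)) := by fun_prop
  refine (integrable_one_add_sq_mul_norm_sq ψ).mono'
    (hm.aestronglyMeasurable.mul (by fun_prop)) (Filter.Eventually.of_forall fun ξ => ?_)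
  rw [Real.norm_of_nonneg (by positivity)]
  gcongr
  exact rpow_le_one_add_sq (norm_nonneg _) (by linarith) (by linarith)

/-- Plancherel's identity for the Riesz gradient of a test function. -/
theorem exists_norm_sq_sigmaGrad_eq (hN : 1 ≤ N) {σ : ℝ} (hσ0 : 0 < σ) (hσ1 : σ < 1) :
    ∃ c : ℝ, 0 < c ∧ ∀ (φ : Rn N → ℝ) (hφ : IsTestFunction Set.univ φ)
      (F : Lp (Rn N) 2 (volume : Measure (Rn N))), HasSigmaGrad σ φ F →
        ‖F‖ ^ 2 = c * ∫ ξ, ‖ξ‖ ^ (2 * σ) * ‖𝓕 hφ.comp_neg.toSchwartz ξ‖ ^ 2 := by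
  have hN' : (1 : ℝ) ≤ N := by exact_mod_cast hN
  obtain ⟨c, hc0, hc⟩ := exists_integral_rieszPotential_mul_fderiv hN (α := 1 - σ)
    (by linarith) (by linarith)
  refine ⟨c ^ 2, by positivity, fun φ hφ F hF => ?_⟩
  set ψ := 𝓕 hφ.comp_neg.toSchwartz with hψ
  -- The expected `L²` function with `F_j = 𝓕 q_j`. The sign comes from the distributional
  -- derivative, and `∑_j |q_j|² = c² |ξ|^{2σ} |ψ|²` off the origin since `2 - 2(1 - σ) = 2σ`.
  let q : Fin N → Rn N → ℂ := fun j ξ =>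
    ((-c * (ξ j * ‖ξ‖ ^ (-(1 - σ))) : ℝ) : ℂ) * (Complex.I * ψ ξ)
  have hqn : ∀ j ξ, ‖q j ξ‖ ^ 2 = c ^ 2 * (ξ j ^ 2 * (‖ξ‖ ^ (-(1 - σ))) ^ 2 * ‖ψ ξ‖ ^ 2) := by
    intro j ξ
    simp only [q, norm_mul, Complex.norm_real, Complex.norm_I, one_mul, mul_pow, norm_neg,
      Real.norm_eq_abs, sq_abs]
    ring
  have hnorm : ∀ ξ : Rn N, 0 < ‖ξ‖ → ‖ξ‖ ^ 2 * (‖ξ‖ ^ (-(1 - σ))) ^ 2 = ‖ξ‖ ^ (2 * σ) := by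
    intro ξ hξ
    rw [← Real.rpow_natCast, ← Real.rpow_natCast, ← Real.rpow_mul hξ.le, ← Real.rpow_add hξ]
    congr 1
    push_cast; ring
  have hIσ := integrable_rpow_mul_norm_sq hσ0.le hσ1.le ψ
  have hqm : ∀ j, MemLp (q j) 2 (volume : Measure (Rn N)) := by
    intro j
    have hmeas : AEStronglyMeasurable (q j) volume := by
      have hm : Measurable (fun ξ : Rn N => ((-c * (ξ j * ‖ξ‖ ^ (-(1 - σ))) : ℝ) : ℂ)) := by
        fun_prop
      exact hm.aestronglyMeasurable.mul (by fun_prop)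
    rw [memLp_two_iff_integrable_sq_norm hmeas]
    refine (hIσ.const_mul (c ^ 2)).mono' (by fun_prop) ?_
    filter_upwards [ae_norm_pos hN] with ξ hξ
    rw [Real.norm_of_nonneg (by positivity), hqn, ← hnorm ξ hξ]
    have hj : ξ j ^ 2 ≤ ‖ξ‖ ^ 2 := by
      rw [← sq_abs, ← Real.norm_eq_abs]
      gcongr
      exact PiLp.norm_apply_le ξ j
    exact mul_le_mul_of_nonneg_left (mul_le_mul_of_nonneg_right
      (mul_le_mul_of_nonneg_right hj (sq_nonneg _)) (sq_nonneg _)) (sq_nonneg _)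
  let Q : Fin N → Lp ℂ 2 (volume : Measure (Rn N)) := fun j => (hqm j).toLp (q j)
  let P : Fin N → (Rn N →L[ℝ] ℂ) := fun j => Complex.ofRealCLM ∘L EuclideanSpace.proj j
  -- The two `L²` functions agree against every test function: `𝓕` is moved onto `v` by tempered
  -- duality, and the pairing is then the one computed for the Riesz potential.
  have hFQ : ∀ j, (P j).compLp F = 𝓕 (Q j) := by
    intro j
    apply Lp.ext
    refine ae_eq_of_integral_contDiff_smul_eq ((Lp.memLp _).locallyIntegrable (by norm_num))
      ((Lp.memLp _).locallyIntegrable (by norm_num)) fun v hv1 hv2 => ?_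
    have hv : IsTestFunction Set.univ v := ⟨hv1, hv2, Set.subset_univ _⟩
    have e1 : ∫ x, v x • (P j).compLp F x = ((∫ x, F x j * v x : ℝ) : ℂ) := by
      rw [← integral_complex_ofReal]
      refine integral_congr_ae ?_
      filter_upwards [(P j).coeFn_compLp F] with x hx
      rw [hx]
      simp [P, mul_comm]
    have e2 : ∫ x, v x • (𝓕 (Q j)) x = ∫ ξ, 𝓕 hv.toSchwartz ξ • q j ξ := by
      have h1 := Lp.toTemperedDistribution_apply (𝓕 (Q j)) hv.toSchwartz
      rw [← Lp.fourier_toTemperedDistribution_eq, TemperedDistribution.fourier_apply,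
        Lp.toTemperedDistribution_apply] at h1
      refine Eq.trans ?_ (h1.symm.trans ?_)
      · simp [IsTestFunction.toSchwartz_apply]
      · refine integral_congr_ae ?_
        filter_upwards [(hqm j).coeFn_toLp] with x hx
        simp only [Q]
        rw [hx]
    rw [e1, e2, hF v hv j, Complex.ofReal_neg, hc φ v hφ hv, ← integral_neg]
    refine integral_congr_ae (Filter.Eventually.of_forall fun ξ => ?_)
    have hin : inner ℝ ξ (EuclideanSpace.single j (1 : ℝ)) = ξ j := by
      simp [EuclideanSpace.inner_single_right]
    simp [q, hψ, hin]
  have hFj : ∀ j, ∫ x, F x j ^ 2 = ∫ ξ, ‖q j ξ‖ ^ 2 := by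
    intro j
    have h1 : ‖(P j).compLp F‖ ^ 2 = ‖Q j‖ ^ 2 := by rw [hFQ, Lp.norm_fourier_eq]
    rw [norm_lp_two_sq, norm_lp_two_sq] at h1
    refine Eq.trans ?_ (h1.trans ?_)
    · refine integral_congr_ae ?_
      filter_upwards [(P j).coeFn_compLp F] with x hx
      rw [hx]
      simp [P]
    · refine integral_congr_ae ?_
      filter_upwards [(hqm j).coeFn_toLp] with x hx
      simp only [Q]
      rw [hx]
  have hFint : ∀ j, Integrable (fun x => F x j ^ 2) := by
    intro j
    have h1 : MemLp (fun x => F x j) 2 (volume : Measure (Rn N)) :=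
      ((EuclideanSpace.proj j : Rn N →L[ℝ] ℝ)).comp_memLp' (Lp.memLp F)
    exact h1.integrable_sq
  rw [norm_lp_two_sq]
  simp only [EuclideanSpace.norm_sq_eq (𝕜 := ℝ), Real.norm_eq_abs, sq_abs]
  rw [integral_finsetSum _ fun j _ => hFint j]
  simp only [hFj]
  rw [← integral_finsetSum _ fun j _ => (hqm j).integrable_norm_pow (by norm_num),
    ← integral_const_mul]
  refine integral_congr_ae ?_
  filter_upwards [ae_norm_pos hN] with ξ hξ
  simp only [hqn]
  rw [← hnorm ξ hξ, ← Finset.mul_sum, ← Finset.sum_mul, ← Finset.sum_mul,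
    EuclideanSpace.norm_sq_eq (𝕜 := ℝ)]
  simp only [Real.norm_eq_abs, sq_abs]

end Poincare

end SigmaGrad

namespace SigmaGrad

open MeasureTheory
open scoped SchwartzMap FourierTransform ContDiff ENNReal

/-! ### The fractional Poincaré inequality -/

section Poincare

variable {N : ℕ}

/-- Cauchy–Schwarz, obtained by expanding `0 ≤ ∫_B (V |φ| - M)²` with `V = |B|` and `M = ∫ |φ|`. -/
theorem sq_integral_norm_le_of_tsupport {φ : Rn N → ℝ} {B : Set (Rn N)} (hφ : IsTestFunction B φ)
    (hB0 : 0 < volume.real B) :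
    (∫ x, ‖φ x‖) ^ 2 ≤ volume.real B * ∫ x, φ x ^ 2 := by
  have hBfin : volume B ≠ ⊤ := fun h => by simp [Measure.real, h] at hB0
  have : IsFiniteMeasure (volume.restrict B) := ⟨by simpa using hBfin.lt_top⟩
  have hz : ∀ x, x ∉ B → φ x = 0 := fun x hx =>
    image_eq_zero_of_notMem_tsupport fun h => hx (hφ.2.2 h)
  have h1 : ∫ x in B, ‖φ x‖ = ∫ x, ‖φ x‖ :=
    setIntegral_eq_integral_of_forall_compl_eq_zero fun x hx => by simp [hz x hx]
  have h2 : ∫ x in B, φ x ^ 2 = ∫ x, φ x ^ 2 :=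
    setIntegral_eq_integral_of_forall_compl_eq_zero fun x hx => by simp [hz x hx]
  have i1 : Integrable (fun x => ‖φ x‖) (volume.restrict B) := hφ.integrable.norm.restrict
  have i2 : Integrable (fun x => φ x ^ 2) (volume.restrict B) := by
    refine Integrable.restrict ?_
    have hc : HasCompactSupport (fun x => φ x ^ 2) :=
      HasCompactSupport.comp_left (g := fun r : ℝ => r ^ 2) hφ.2.1 (zero_pow two_ne_zero)
    exact (hφ.1.continuous.pow 2).integrable_of_hasCompactSupport hc
  set V := volume.real B
  set M := ∫ x, ‖φ x‖
  have h3 : 0 ≤ ∫ x in B, (V * ‖φ x‖ - M) ^ 2 := integral_nonneg fun x => sq_nonneg _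
  have e : ∀ x, (V * ‖φ x‖ - M) ^ 2 = V ^ 2 * φ x ^ 2 - (2 * V * M) * ‖φ x‖ + M ^ 2 := fun x => by
    rw [sub_sq, mul_pow, Real.norm_eq_abs, sq_abs]; ring
  simp only [e] at h3
  have i3 : Integrable (fun x => V ^ 2 * φ x ^ 2 - 2 * V * M * ‖φ x‖) (volume.restrict B) :=
    (i2.const_mul _).sub (i1.const_mul _)
  rw [integral_add i3 (integrable_const _),
    integral_sub (i2.const_mul _) (i1.const_mul _), integral_const_mul, integral_const_mul, h1, h2,
    integral_const, smul_eq_mul] at h3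
  have hV : (volume.restrict B).real Set.univ = V := by simp [V, Measure.real]
  rw [hV] at h3
  have h4 : 0 ≤ V * (V * ∫ x, φ x ^ 2) - V * M ^ 2 := by
    have : V ^ 2 * (∫ x, φ x ^ 2) - 2 * V * M * M + V * M ^ 2
      = V * (V * ∫ x, φ x ^ 2) - V * M ^ 2 := by ring
    linarith
  rw [← mul_sub] at h4
  have := nonneg_of_mul_nonneg_right h4 hB0
  linarith

theorem norm_fourier_le_integral_norm {v : Rn N → ℝ} (hv : IsTestFunction Set.univ v)
    (ξ : Rn N) : ‖𝓕 hv.toSchwartz ξ‖ ≤ ∫ x, ‖v x‖ := by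
  have := VectorFourier.norm_fourierIntegral_le_integral_norm Real.fourierChar volume
    (innerₗ (Rn N)) (hv.toSchwartz : Rn N → ℂ) ξ
  simpa [IsTestFunction.toSchwartz_apply] using! this

/-- The fractional Poincaré inequality for test functions. -/
theorem exists_integral_sq_le_norm_sq (hN : 1 ≤ N) {σ : ℝ} (hσ0 : 0 < σ) (hσ1 : σ < 1)
    {Ω : Set (Rn N)} (hΩ : Bornology.IsBounded Ω) :
    ∃ C : ℝ, 0 ≤ C ∧ ∀ (φ : Rn N → ℝ), IsTestFunction Ω φ →
      ∀ F : Lp (Rn N) 2 (volume : Measure (Rn N)), HasSigmaGrad σ φ F →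
        ∫ x, φ x ^ 2 ≤ C * ‖F‖ ^ 2 := by
  obtain ⟨c, hc0, hc⟩ := exists_norm_sq_sigmaGrad_eq hN hσ0 hσ1
  have : Nonempty (Fin N) := ⟨⟨0, hN⟩⟩
  obtain ⟨R, hR0, hR⟩ := hΩ.subset_ball_lt 0 0
  set V := volume.real (Metric.ball (0 : Rn N) R) with hV
  have hV0 : 0 < V := ENNReal.toReal_pos (Metric.measure_ball_pos volume _ hR0).ne'
    measure_ball_lt_top.ne
  set b := volume.real (Metric.ball (0 : Rn N) 1) with hb
  have hb0 : 0 ≤ b := measureReal_nonneg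
  -- The frequency cutoff is chosen so that `|B_ε| |B_R| ≤ 1/2`. Below it, `|ψ|² ≤ ‖φ‖₁² ≤ V ‖φ‖₂²`,
  -- so these frequencies carry at most half of `‖φ‖₂²` and are absorbed. Above it, `1 ≤ ε^(-2σ)
  -- |ξ|^(2σ)`.
  set ε : ℝ := min 1 (1 / (2 * (b * V + 1))) with hε
  have hε0 : 0 < ε := by positivity
  have hε1 : ε ≤ 1 := min_le_left _ _
  have hball : volume.real (Metric.ball (0 : Rn N) ε) * V ≤ 1 / 2 := by
    have h1 : volume.real (Metric.ball (0 : Rn N) ε) = ε ^ N * b := by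
      rw [Measure.real, Measure.addHaar_ball _ _ hε0.le, ENNReal.toReal_mul,
        ENNReal.toReal_ofReal (by positivity)]
      simp [hb, Measure.real]
    have h2 : ε ^ N ≤ ε := pow_le_of_le_one hε0.le hε1 (by omega)
    have h3 : ε ≤ 1 / (2 * (b * V + 1)) := min_le_right _ _
    rw [h1]
    calc ε ^ N * b * V ≤ 1 / (2 * (b * V + 1)) * b * V := by gcongr; exact h2.trans h3
      _ ≤ 1 / 2 := by
        rw [div_mul_eq_mul_div, div_mul_eq_mul_div, div_le_div_iff₀ (by positivity) two_pos]
        linarith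
  refine ⟨2 * (ε ^ (-(2 * σ)) / c), by positivity, fun φ hφ F hF => ?_⟩
  have hφB : IsTestFunction (Metric.ball (0 : Rn N) R) φ := ⟨hφ.1, hφ.2.1, hφ.2.2.trans hR⟩
  have hCS := sq_integral_norm_le_of_tsupport hφB hV0
  have hF2 := hc φ hφ.univ F hF
  set ψ := 𝓕 hφ.univ.comp_neg.toSchwartz with hψ
  set S := ∫ x, φ x ^ 2 with hS
  set M := ∫ x, ‖φ x‖ with hM
  have hψS : ∫ ξ, ‖ψ ξ‖ ^ 2 = S := by
    rw [hψ, SchwartzMap.integral_norm_sq_fourier, hS, ← integral_neg_eq_self]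
    simp [IsTestFunction.toSchwartz_apply]
  have hψM : ∀ ξ, ‖ψ ξ‖ ≤ M := fun ξ => by
    refine (norm_fourier_le_integral_norm hφ.univ.comp_neg ξ).trans_eq ?_
    exact integral_neg_eq_self (fun x => ‖φ x‖) volume
  have hI := integrable_rpow_mul_norm_sq hσ0.le hσ1.le ψ
  have hind : Integrable ((Metric.ball (0 : Rn N) ε).indicator (fun _ => M ^ 2)) :=
    (integrable_indicator_iff measurableSet_ball).2
      (integrableOn_const measure_ball_lt_top.ne)
  have hpt : ∀ ξ, ‖ψ ξ‖ ^ 2 ≤ (Metric.ball (0 : Rn N) ε).indicator (fun _ => M ^ 2) ξ +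
      ε ^ (-(2 * σ)) * (‖ξ‖ ^ (2 * σ) * ‖ψ ξ‖ ^ 2) := by
    intro ξ
    by_cases hξ : ξ ∈ Metric.ball (0 : Rn N) ε
    · rw [Set.indicator_of_mem hξ]
      have h1 : ‖ψ ξ‖ ^ 2 ≤ M ^ 2 := by gcongr; exact hψM ξ
      have h2 : 0 ≤ ε ^ (-(2 * σ)) * (‖ξ‖ ^ (2 * σ) * ‖ψ ξ‖ ^ 2) := by positivity
      linarith
    · rw [Set.indicator_of_notMem hξ, zero_add, ← mul_assoc]
      have h1 : ε ≤ ‖ξ‖ := by simpa using hξ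
      refine le_mul_of_one_le_left (by positivity) ?_
      rw [Real.rpow_neg hε0.le, ← div_eq_inv_mul, one_le_div (by positivity)]
      gcongr
  have hint : S ≤ volume.real (Metric.ball (0 : Rn N) ε) * M ^ 2 +
      ε ^ (-(2 * σ)) * ∫ ξ, ‖ξ‖ ^ (2 * σ) * ‖ψ ξ‖ ^ 2 := by
    rw [← hψS]
    refine (integral_mono_of_nonneg (Filter.Eventually.of_forall fun ξ => by positivity)
      (hind.add (hI.const_mul _)) (Filter.Eventually.of_forall hpt)).trans_eq ?_
    simp only [Pi.add_apply]
    rw [integral_add hind (hI.const_mul _), integral_const_mul,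
      integral_indicator measurableSet_ball, setIntegral_const, smul_eq_mul]
  have h5 : volume.real (Metric.ball (0 : Rn N) ε) * M ^ 2 ≤ 1 / 2 * S := by
    have hS0 : 0 ≤ S := integral_nonneg fun x => sq_nonneg _
    calc volume.real (Metric.ball (0 : Rn N) ε) * M ^ 2
        ≤ volume.real (Metric.ball (0 : Rn N) ε) * (V * S) := by gcongr
      _ = volume.real (Metric.ball (0 : Rn N) ε) * V * S := by ring
      _ ≤ 1 / 2 * S := by gcongr
  rw [hF2]
  have h6 : 2 * (ε ^ (-(2 * σ)) / c) * (c * ∫ ξ, ‖ξ‖ ^ (2 * σ) * ‖ψ ξ‖ ^ 2) =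
      2 * (ε ^ (-(2 * σ)) * ∫ ξ, ‖ξ‖ ^ (2 * σ) * ‖ψ ξ‖ ^ 2) := by
    field_simp
  rw [h6]
  linarith

end Poincare

end SigmaGrad

namespace SigmaGrad

open MeasureTheory
open scoped ContDiff ENNReal

/-! ### Closedness of the Riesz gradient and completeness of `H^σ_0(Ω)` -/

section Graph

variable {N : ℕ}

/-- A pointwise closed constraint defines a closed subset of `L^p`. -/
theorem isClosed_setOf_ae_mem {X F : Type*} [MeasurableSpace X] {μ : Measure X}
    [NormedAddCommGroup F] {p : ℝ≥0∞} [Fact (1 ≤ p)] {S : X → Set F} (hS : ∀ x, IsClosed (S x)) :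
    IsClosed {f : Lp F p μ | ∀ᵐ x ∂μ, f x ∈ S x} := by
  refine IsSeqClosed.isClosed fun f g hf hfg => ?_
  obtain ⟨n, -, hn⟩ := (tendstoInMeasure_of_tendsto_Lp hfg).exists_seq_tendsto_ae
  filter_upwards [hn, ae_all_iff.2 hf] with x hx hx'
  exact (hS x).mem_of_tendsto hx (Filter.Eventually.of_forall fun k => hx' (n k))

theorem rieszPotential_congr_ae {α : ℝ} {u v : Rn N → ℝ} (h : u =ᵐ[volume] v) :
    rieszPotential α u = rieszPotential α v := by
  funext x
  unfold rieszPotential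
  congr 1
  refine integral_congr_ae ?_
  filter_upwards [h] with y hy
  rw [hy]

theorem HasSigmaGrad.congr_ae {σ : ℝ} {u v : Rn N → ℝ} (h : u =ᵐ[volume] v)
    {F : Lp (Rn N) 2 (volume : Measure (Rn N))} (hF : HasSigmaGrad σ u F) :
    HasSigmaGrad σ v F := by
  unfold HasSigmaGrad at *
  rwa [← rieszPotential_congr_ae h]

/-- The square integrable functions vanishing almost everywhere outside `B`. -/
def supportedIn (B : Set (Rn N)) : Set (Lp ℝ 2 (volume : Measure (Rn N))) :=
  {u | ∀ᵐ x, u x ∈ {r : ℝ | x ∉ B → r = 0}}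

theorem isClosed_supportedIn (B : Set (Rn N)) : IsClosed (supportedIn B) := by
  refine isClosed_setOf_ae_mem fun x => ?_
  by_cases hx : x ∈ B
  · simp [hx]
  · simp [hx]

theorem indicator_ae_eq_of_mem_supportedIn {B : Set (Rn N)}
    {u : Lp ℝ 2 (volume : Measure (Rn N))} (hu : u ∈ supportedIn B) :
    B.indicator u =ᵐ[volume] u := by
  filter_upwards [hu] with x hx
  by_cases h : x ∈ B
  · rw [Set.indicator_of_mem h]
  · rw [Set.indicator_of_notMem h, hx h]

theorem integrable_of_mem_supportedIn {R : ℝ} {u : Lp ℝ 2 (volume : Measure (Rn N))}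
    (hu : u ∈ supportedIn (Metric.ball (0 : Rn N) R)) : Integrable u := by
  refine Integrable.congr ?_ (indicator_ae_eq_of_mem_supportedIn hu)
  rw [integrable_indicator_iff measurableSet_ball]
  have : IsFiniteMeasure (volume.restrict (Metric.ball (0 : Rn N) R)) :=
    ⟨by simpa using measure_ball_lt_top⟩
  exact ((Lp.memLp u).restrict _).integrable (by norm_num)

/-- On functions supported in a fixed ball, the relation defining the Riesz gradient is given by
continuous linear functionals. -/
theorem exists_dual_hasSigmaGrad (hN : 1 ≤ N) {σ : ℝ} (hσ0 : 0 < σ) (hσ1 : σ < 1) (R : ℝ)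
    {v : Rn N → ℝ} (hv : IsTestFunction Set.univ v) (j : Fin N) :
    ∃ (a : Lp ℝ 2 (volume : Measure (Rn N))) (b : Lp (Rn N) 2 (volume : Measure (Rn N))),
      ∀ u ∈ supportedIn (Metric.ball (0 : Rn N) R),
        ∀ F : Lp (Rn N) 2 (volume : Measure (Rn N)),
        ((∫ x, F x j * v x = - ∫ x, rieszPotential (1 - σ) u x *
            fderiv ℝ v x (EuclideanSpace.single j 1)) ↔
          inner ℝ a u + inner ℝ b F = 0) := by
  have hN' : (1 : ℝ) ≤ N := by exact_mod_cast hN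
  set w : Rn N → ℝ := fun x => fderiv ℝ v x (EuclideanSpace.single j 1) with hw
  have hwt : IsTestFunction Set.univ w := hv.fderiv_apply _
  set β : ℝ := (N : ℝ) - (1 - σ) with hβ
  have hβ0 : 0 ≤ β := by rw [hβ]; linarith
  have hβN : β < N := by rw [hβ]; linarith
  obtain ⟨Cw, hCw⟩ := hwt.exists_bound
  obtain ⟨M, hM0, hM⟩ :=
    exists_integral_norm_sub_rpow_neg_mul_le hN hβ0 hβN hwt.integrable hCw
  -- By symmetry of the kernel, the potential is moved from `u` onto the fixed function `w = ∂_j v`.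
  -- The result is bounded, so its cutoff to the ball is in `L²`; the cutoff is harmless because `u`
  -- vanishes outside.
  set h : Rn N → ℝ := fun y => ∫ x, ‖x - y‖ ^ (-β) * w x with hh
  have hbound : ∀ y, ‖h y‖ ≤ M := fun y => by
    refine (norm_integral_le_integral_norm _).trans (le_of_eq_of_le ?_ (hM y))
    refine integral_congr_ae (Filter.Eventually.of_forall fun x => ?_)
    simp only [norm_mul]
    rw [Real.norm_of_nonneg (by positivity : 0 ≤ ‖x - y‖ ^ (-β))]
  have hmeas : AEStronglyMeasurable h volume := by
    have hm : Measurable (fun p : Rn N × Rn N => ‖p.2 - p.1‖ ^ (-β)) := by fun_prop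
    have hc : Continuous (fun p : Rn N × Rn N => w p.2) := hwt.1.continuous.comp continuous_snd
    exact (hm.aestronglyMeasurable.mul hc.aestronglyMeasurable).integral_prod_right'
      (μ := volume) (ν := volume) (f := fun p : Rn N × Rn N => ‖p.2 - p.1‖ ^ (-β) * w p.2)
  have ha : MemLp ((Metric.ball (0 : Rn N) R).indicator fun y => rieszConst N (1 - σ) * h y) 2
      (volume : Measure (Rn N)) := by
    rw [memLp_indicator_iff_restrict measurableSet_ball]
    have : IsFiniteMeasure (volume.restrict (Metric.ball (0 : Rn N) R)) :=
      ⟨by simpa using measure_ball_lt_top⟩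
    refine MemLp.of_bound (hmeas.const_mul _).restrict (‖rieszConst N (1 - σ)‖ * M)
      (Filter.Eventually.of_forall fun y => ?_)
    rw [norm_mul]
    gcongr
    exact hbound y
  have hb : MemLp (fun x => v x • EuclideanSpace.single j (1 : ℝ)) 2
      (volume : Measure (Rn N)) := by
    have hc : Continuous (fun x => v x • EuclideanSpace.single j (1 : ℝ)) :=
      hv.1.continuous.smul continuous_const
    exact hc.memLp_of_hasCompactSupport hv.2.1.smul_right
  refine ⟨ha.toLp _, hb.toLp _, fun u hu F => ?_⟩
  have e1 : inner ℝ (hb.toLp _) F = ∫ x, F x j * v x := by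
    rw [L2.inner_def]
    refine integral_congr_ae ?_
    filter_upwards [hb.coeFn_toLp] with x hx
    rw [hx, real_inner_smul_left, EuclideanSpace.inner_single_left]
    simp [mul_comm]
  have e2 : inner ℝ (ha.toLp _) u = ∫ x, rieszPotential (1 - σ) u x * w x := by
    have h1 : ∫ x, rieszPotential (1 - σ) u x * w x =
        rieszConst N (1 - σ) * ∫ y, u y * h y := by
      rw [hh, ← integral_riesz_mul_comm hN hβ0 hβN (integrable_of_mem_supportedIn hu)
        hwt.integrable hCw, ← integral_const_mul]
      simp only [rieszPotential, mul_assoc, hβ]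
    rw [h1, ← integral_const_mul, L2.inner_def]
    refine integral_congr_ae ?_
    filter_upwards [ha.coeFn_toLp, hu] with x hx hux
    rw [hx]
    by_cases hxB : x ∈ Metric.ball (0 : Rn N) R
    · rw [Set.indicator_of_mem hxB]
      simp only [RCLike.inner_apply, conj_trivial]
      ring
    · rw [Set.indicator_of_notMem hxB, hux hxB]
      simp
  rw [e1, e2, eq_neg_iff_add_eq_zero, add_comm]

/-- The graph of the Riesz gradient over the functions supported in a ball. -/
def sigmaGraph (hN : 1 ≤ N) {σ : ℝ} (hσ0 : 0 < σ) (hσ1 : σ < 1) (R : ℝ) :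
    Submodule ℝ (Lp ℝ 2 (volume : Measure (Rn N)) × Lp (Rn N) 2 (volume : Measure (Rn N))) where
  carrier := {p | p.1 ∈ supportedIn (Metric.ball (0 : Rn N) R) ∧ HasSigmaGrad σ p.1 p.2}
  zero_mem' := by
    have h0 : (0 : Lp ℝ 2 (volume : Measure (Rn N))) ∈
        supportedIn (Metric.ball (0 : Rn N) R) := by
      filter_upwards [Lp.coeFn_zero ℝ 2 (volume : Measure (Rn N))] with x hx _
      rw [hx]; rfl
    refine ⟨h0, fun v hv j => ?_⟩
    obtain ⟨a, b, hab⟩ := exists_dual_hasSigmaGrad hN hσ0 hσ1 R hv j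
    exact (hab _ h0 _).2 (by simp)
  add_mem' := by
    rintro ⟨u₁, F₁⟩ ⟨u₂, F₂⟩ ⟨h₁, g₁⟩ ⟨h₂, g₂⟩
    have h : u₁ + u₂ ∈ supportedIn (Metric.ball (0 : Rn N) R) := by
      filter_upwards [h₁, h₂, Lp.coeFn_add u₁ u₂] with x hx₁ hx₂ hx hxB
      rw [hx, Pi.add_apply, hx₁ hxB, hx₂ hxB, add_zero]
    refine ⟨h, fun v hv j => ?_⟩
    -- Additivity is read off from the linear functional, which avoids checking integrability of the
    -- potentials of the two summands.
    obtain ⟨a, b, hab⟩ := exists_dual_hasSigmaGrad hN hσ0 hσ1 R hv j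
    have e₁ := (hab _ h₁ _).1 (g₁ v hv j)
    have e₂ := (hab _ h₂ _).1 (g₂ v hv j)
    refine (hab _ h _).2 ?_
    change inner ℝ a (u₁ + u₂) + inner ℝ b (F₁ + F₂) = 0
    rw [inner_add_right, inner_add_right]
    linarith
  smul_mem' := by
    rintro c ⟨u, F⟩ ⟨hu, g⟩
    have h : c • u ∈ supportedIn (Metric.ball (0 : Rn N) R) := by
      filter_upwards [hu, Lp.coeFn_smul c u] with x hx₁ hx hxB
      rw [hx, Pi.smul_apply, hx₁ hxB, smul_zero]
    refine ⟨h, fun v hv j => ?_⟩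
    obtain ⟨a, b, hab⟩ := exists_dual_hasSigmaGrad hN hσ0 hσ1 R hv j
    have e := (hab _ hu _).1 (g v hv j)
    refine (hab _ h _).2 ?_
    change inner ℝ a (c • u) + inner ℝ b (c • F) = 0
    rw [real_inner_smul_right, real_inner_smul_right, ← mul_add, e, mul_zero]

theorem isClosed_sigmaGraph (hN : 1 ≤ N) {σ : ℝ} (hσ0 : 0 < σ) (hσ1 : σ < 1) (R : ℝ) :
    IsClosed (sigmaGraph hN hσ0 hσ1 R :
      Set (Lp ℝ 2 (volume : Measure (Rn N)) × Lp (Rn N) 2 (volume : Measure (Rn N)))) := by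
  refine IsSeqClosed.isClosed fun p q hp hpq => ?_
  have h1 : Filter.Tendsto (fun n => (p n).1) Filter.atTop (nhds q.1) :=
    (continuous_fst.tendsto q).comp hpq
  have h2 : Filter.Tendsto (fun n => (p n).2) Filter.atTop (nhds q.2) :=
    (continuous_snd.tendsto q).comp hpq
  have hs : q.1 ∈ supportedIn (Metric.ball (0 : Rn N) R) :=
    (isClosed_supportedIn _).mem_of_tendsto h1 (Filter.Eventually.of_forall fun n => (hp n).1)
  refine ⟨hs, fun v hv j => ?_⟩
  obtain ⟨a, b, hab⟩ := exists_dual_hasSigmaGrad hN hσ0 hσ1 R hv j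
  refine (hab _ hs _).2 ?_
  have ht : Filter.Tendsto (fun n => inner ℝ a (p n).1 + inner ℝ b (p n).2) Filter.atTop
      (nhds (inner ℝ a q.1 + inner ℝ b q.2)) :=
    (tendsto_const_nhds.inner h1).add (tendsto_const_nhds.inner h2)
  refine tendsto_nhds_unique ht ?_
  have : (fun n => inner ℝ a (p n).1 + inner ℝ b (p n).2) = fun _ => (0 : ℝ) :=
    funext fun n => (hab _ (hp n).1 _).1 ((hp n).2 v hv j)
  rw [this]
  exact tendsto_const_nhds

theorem IsTestFunction.mem_supportedIn {U : Set (Rn N)} {φ : Rn N → ℝ} (hφ : IsTestFunction U φ)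
    {u : Lp ℝ 2 (volume : Measure (Rn N))} (hu : u =ᵐ[volume] φ) : u ∈ supportedIn U := by
  filter_upwards [hu] with x hx hxU
  rw [hx]
  exact image_eq_zero_of_notMem_tsupport fun h => hxU (hφ.2.2 h)

/-- The graph of the Riesz gradient over `C_c^∞(Ω)`, as a linear subspace. -/
def testGraphSubmodule (hN : 1 ≤ N) {σ : ℝ} (hσ0 : 0 < σ) (hσ1 : σ < 1) {Ω : Set (Rn N)}
    {R : ℝ} (hR : Ω ⊆ Metric.ball 0 R) :
    Submodule ℝ (Lp ℝ 2 (volume : Measure (Rn N)) × Lp (Rn N) 2 (volume : Measure (Rn N))) where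
  carrier := testGraph Ω σ
  zero_mem' := by
    refine ⟨⟨fun _ => 0, ⟨contDiff_const, HasCompactSupport.zero, ?_⟩,
      Lp.coeFn_zero ℝ 2 volume⟩, (zero_mem (sigmaGraph hN hσ0 hσ1 R)).2⟩
    simp [tsupport]
  add_mem' := by
    rintro ⟨u₁, F₁⟩ ⟨u₂, F₂⟩ ⟨⟨φ₁, h₁, e₁⟩, g₁⟩ ⟨⟨φ₂, h₂, e₂⟩, g₂⟩
    have m₁ : (u₁, F₁) ∈ sigmaGraph hN hσ0 hσ1 R :=
      ⟨(IsTestFunction.mem_supportedIn ⟨h₁.1, h₁.2.1, h₁.2.2.trans hR⟩ e₁), g₁⟩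
    have m₂ : (u₂, F₂) ∈ sigmaGraph hN hσ0 hσ1 R :=
      ⟨(IsTestFunction.mem_supportedIn ⟨h₂.1, h₂.2.1, h₂.2.2.trans hR⟩ e₂), g₂⟩
    refine ⟨⟨fun x => φ₁ x + φ₂ x, ⟨h₁.1.add h₂.1, h₁.2.1.add h₂.2.1, ?_⟩, ?_⟩,
      (add_mem m₁ m₂).2⟩
    · exact (tsupport_add φ₁ φ₂).trans (Set.union_subset h₁.2.2 h₂.2.2)
    · filter_upwards [e₁, e₂, Lp.coeFn_add u₁ u₂] with x hx₁ hx₂ hx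
      change (u₁ + u₂ : Lp ℝ 2 (volume : Measure (Rn N))) x = _
      rw [hx, Pi.add_apply, hx₁, hx₂]
  smul_mem' := by
    rintro c ⟨u, F⟩ ⟨⟨φ, h, e⟩, g⟩
    have m : (u, F) ∈ sigmaGraph hN hσ0 hσ1 R :=
      ⟨(IsTestFunction.mem_supportedIn ⟨h.1, h.2.1, h.2.2.trans hR⟩ e), g⟩
    refine ⟨⟨fun x => c * φ x, ⟨contDiff_const.mul h.1, h.2.1.mul_left, ?_⟩, ?_⟩,
      (Submodule.smul_mem _ c m).2⟩
    · exact (closure_mono (Function.support_mul_subset_right _ _)).trans h.2.2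
    · filter_upwards [e, Lp.coeFn_smul c u] with x hx₁ hx
      change (c • u : Lp ℝ 2 (volume : Measure (Rn N))) x = _
      rw [hx, Pi.smul_apply, hx₁, smul_eq_mul]

/-- A closed linear relation whose first component is controlled by the second one is the graph
of a linear map on a closed subspace. -/
theorem exists_linearMap_of_isClosed_graph {E F : Type*} [NormedAddCommGroup E] [NormedSpace ℝ E]
    [CompleteSpace E] [NormedAddCommGroup F] [NormedSpace ℝ F] [CompleteSpace F]
    (W : Submodule ℝ (E × F)) (hW : IsClosed (W : Set (E × F))) {C : ℝ}
    (hC : ∀ p ∈ W, ‖p.1‖ ≤ C * ‖p.2‖) :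
    ∃ (D : Submodule ℝ F) (L : D →ₗ[ℝ] E), IsClosed (D : Set F) ∧ (∀ d, (L d, (d : F)) ∈ W) ∧
      ∀ p ∈ W, ∃ d, L d = p.1 := by
  let f : W →ₗ[ℝ] F := (LinearMap.snd ℝ E F).comp W.subtype
  -- The second projection is bounded below on the complete space `W`, hence injective with closed
  -- range; `L` is its inverse followed by the first projection. The `1` in `max C 1` handles the
  -- second component in the sup norm of the product.
  have hanti : ∀ p : W, ‖p‖ ≤ (⟨max C 1, by positivity⟩ : NNReal) * ‖f p‖ := by
    intro p
    change max ‖p.1.1‖ ‖p.1.2‖ ≤ max C 1 * ‖p.1.2‖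
    refine max_le ((hC p.1 p.2).trans ?_)
      (le_mul_of_one_le_left (norm_nonneg _) (le_max_right _ _))
    gcongr
    exact le_max_left _ _
  have hal := AddMonoidHomClass.antilipschitz_of_bound f hanti
  have : CompleteSpace W := hW.completeSpace_coe
  have hfu : UniformContinuous f := uniformContinuous_snd.comp uniformContinuous_subtype_val
  let e := LinearEquiv.ofInjective f hal.injective
  have he : ∀ d : LinearMap.range f, (e.symm d).1.2 = d.1 := fun d =>
    congrArg Subtype.val (e.apply_symm_apply d)
  refine ⟨LinearMap.range f, (LinearMap.fst ℝ E F).comp (W.subtype.comp e.symm.toLinearMap),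
    ?_, fun d => ?_, fun p hp => ⟨e ⟨p, hp⟩, ?_⟩⟩
  · rw [LinearMap.coe_range]
    exact hal.isClosed_range hfu
  · have h := (e.symm d).2
    rw [← he d]
    exact h
  · simp

/-- `H^σ_0(Ω)` is linearly isometric, through `D^σ`, to a closed subspace of `L²(ℝ^N)^N`. -/
theorem exists_gradient_space (hN : 1 ≤ N) {σ : ℝ} (hσ0 : 0 < σ) (hσ1 : σ < 1)
    {Ω : Set (Rn N)} (hΩ : Bornology.IsBounded Ω) :
    ∃ (D : Submodule ℝ (Lp (Rn N) 2 (volume : Measure (Rn N))))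
      (L : D →ₗ[ℝ] Lp ℝ 2 (volume : Measure (Rn N))),
      IsClosed (D : Set (Lp (Rn N) 2 (volume : Measure (Rn N)))) ∧
      (∀ d, L d ∈ H0 Ω σ ∧ sigmaGrad σ (L d) = d) ∧ ∀ u ∈ H0 Ω σ, ∃ d, L d = u := by
  obtain ⟨R, hR⟩ := hΩ.subset_ball 0
  obtain ⟨C, hC0, hC⟩ := exists_integral_sq_le_norm_sq hN hσ0 hσ1 hΩ
  set W := (testGraphSubmodule hN hσ0 hσ1 hR).topologicalClosure with hW
  have hWcl : IsClosed (W : Set (Lp ℝ 2 (volume : Measure (Rn N)) ×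
    Lp (Rn N) 2 (volume : Measure (Rn N)))) := Submodule.isClosed_topologicalClosure _
  have hWmem : ∀ p, p ∈ W ↔ p ∈ closure (testGraph Ω σ) := fun p => Iff.rfl
  have hWgrad : ∀ p ∈ W, HasSigmaGrad σ p.1 p.2 := by
    have : W ≤ sigmaGraph hN hσ0 hσ1 R := by
      refine Submodule.topologicalClosure_minimal _ ?_ (isClosed_sigmaGraph hN hσ0 hσ1 R)
      rintro p ⟨⟨φ, h, e⟩, g⟩
      exact ⟨IsTestFunction.mem_supportedIn ⟨h.1, h.2.1, h.2.2.trans hR⟩ e, g⟩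
    exact fun p hp => (this hp).2
  -- The Poincaré inequality is a closed condition, so it passes from test functions to the closure.
  have hWP : ∀ p ∈ W, ‖p.1‖ ^ 2 ≤ C * ‖p.2‖ ^ 2 := by
    intro p hp
    have hcl : IsClosed {p : Lp ℝ 2 (volume : Measure (Rn N)) ×
        Lp (Rn N) 2 (volume : Measure (Rn N)) | ‖p.1‖ ^ 2 ≤ C * ‖p.2‖ ^ 2} :=
      isClosed_le (by fun_prop) (by fun_prop)
    refine closure_minimal ?_ hcl ((hWmem p).1 hp)
    rintro p ⟨⟨φ, h, e⟩, g⟩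
    have h1 := hC φ h p.2 (g.congr_ae e)
    change ‖p.1‖ ^ 2 ≤ C * ‖p.2‖ ^ 2
    rw [norm_lp_two_sq]
    refine le_of_eq_of_le (integral_congr_ae ?_) h1
    filter_upwards [e] with x hx
    rw [hx, Real.norm_eq_abs, sq_abs]
  obtain ⟨D, L, hD, hL, hsurj⟩ := exists_linearMap_of_isClosed_graph W hWcl
    (C := Real.sqrt C) fun p hp => by
      rw [← Real.sqrt_sq (norm_nonneg p.2), ← Real.sqrt_mul hC0]
      exact Real.le_sqrt_of_sq_le (hWP p hp)
  refine ⟨D, L, hD, fun d => ?_, fun u hu => ?_⟩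
  · have h1 := hWgrad _ (hL d)
    exact ⟨⟨d.1, h1, (hWmem _).1 (hL d)⟩, sigmaGrad_eq h1⟩
  · obtain ⟨F, -, hF⟩ := hu
    exact hsurj (u, F) ((hWmem _).2 hF)

end Graph

end SigmaGrad

namespace SigmaGrad

open MeasureTheory
open scoped ENNReal

/-! ### The bilinear form of the matrix field -/

section Form

variable {N : ℕ}

theorem integrable_norm_mul_norm_lp (F G : Lp (Rn N) 2 (volume : Measure (Rn N))) :
    Integrable (fun x => ‖F x‖ * ‖G x‖) :=
  (Lp.memLp F).norm.integrable_mul (Lp.memLp G).norm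

theorem integral_norm_mul_norm_lp_le (F G : Lp (Rn N) 2 (volume : Measure (Rn N))) :
    ∫ x, ‖F x‖ * ‖G x‖ ≤ ‖F‖ * ‖G‖ := by
  have hF := (Lp.memLp F).norm
  have hG := (Lp.memLp G).norm
  have h := real_inner_le_norm (hG.toLp _) (hF.toLp _)
  rw [Lp.norm_toLp, Lp.norm_toLp, eLpNorm_norm, eLpNorm_norm, ← Lp.norm_def, ← Lp.norm_def,
    L2.inner_def, mul_comm] at h
  refine le_of_eq_of_le (integral_congr_ae ?_) h
  filter_upwards [hF.coeFn_toLp, hG.coeFn_toLp] with x h1 h2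
  rw [h1, h2]
  simp

variable {A : Rn N → Matrix (Fin N) (Fin N) ℝ} {aLow aUp : ℝ}

/-- The one-sided upper bound, applied to `ζ` and `-ζ`, is two-sided. -/
theorem IsEllipticMatrix.norm_inner_le (hA : IsEllipticMatrix A aLow aUp) :
    ∀ᵐ x, ∀ ξ ζ : Rn N, ‖inner ℝ (Matrix.toEuclideanLin (A x) ξ) ζ‖ ≤ aUp * (‖ξ‖ * ‖ζ‖) := by
  filter_upwards [hA.2] with x hx ξ ζ
  have h1 := (hx ξ ζ).2
  have h2 := (hx ξ (-ζ)).2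
  rw [inner_neg_right, norm_neg] at h2
  rw [Real.norm_eq_abs, abs_le]
  constructor <;> linarith

theorem IsEllipticMatrix.integrable_inner (hA : IsEllipticMatrix A aLow aUp)
    (F G : Lp (Rn N) 2 (volume : Measure (Rn N))) :
    Integrable (fun x => inner ℝ (Matrix.toEuclideanLin (A x) (F x)) (G x)) := by
  have hcoord : ∀ (H : Lp (Rn N) 2 (volume : Measure (Rn N))) (j : Fin N),
      AEMeasurable (fun x => H x j) volume := fun H j =>
    (EuclideanSpace.proj j : Rn N →L[ℝ] ℝ).measurable.comp_aemeasurable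
      (Lp.aestronglyMeasurable H).aemeasurable
  have e : (fun x => inner ℝ (Matrix.toEuclideanLin (A x) (F x)) (G x)) =
      fun x => ∑ i, (∑ j, A x i j * F x j) * G x i := by
    funext x
    simp [PiLp.inner_apply, Matrix.toLpLin_apply, Matrix.mulVec, dotProduct, mul_comm]
  have hmeas : AEStronglyMeasurable
      (fun x => inner ℝ (Matrix.toEuclideanLin (A x) (F x)) (G x)) volume := by
    rw [e]
    refine AEMeasurable.aestronglyMeasurable ?_
    refine Finset.aemeasurable_fun_sum _ fun i _ => AEMeasurable.mul ?_ (hcoord G i)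
    exact Finset.aemeasurable_fun_sum _ fun j _ => (hA.1 i j).mul (hcoord F j)
  refine ((integrable_norm_mul_norm_lp F G).const_mul aUp).mono' hmeas ?_
  filter_upwards [hA.norm_inner_le] with x hx
  exact hx _ _

/-- The bilinear form `∫ A F · G` on `L²(ℝ^N)^N`. -/
noncomputable def IsEllipticMatrix.form (hA : IsEllipticMatrix A aLow aUp) (haUp : 0 ≤ aUp) :
    Lp (Rn N) 2 (volume : Measure (Rn N)) →L[ℝ] Lp (Rn N) 2 (volume : Measure (Rn N)) →L[ℝ] ℝ :=
  LinearMap.mkContinuous₂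
    (LinearMap.mk₂ ℝ (fun F G => ∫ x, inner ℝ (Matrix.toEuclideanLin (A x) (F x)) (G x))
      (fun F₁ F₂ G => by
        rw [← integral_add (hA.integrable_inner F₁ G) (hA.integrable_inner F₂ G)]
        refine integral_congr_ae ?_
        filter_upwards [Lp.coeFn_add F₁ F₂] with x hx
        rw [hx, Pi.add_apply, map_add, inner_add_left])
      (fun c F G => by
        rw [smul_eq_mul, ← integral_const_mul]
        refine integral_congr_ae ?_
        filter_upwards [Lp.coeFn_smul c F] with x hx
        rw [hx, Pi.smul_apply, map_smul, real_inner_smul_left])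
      (fun F G₁ G₂ => by
        rw [← integral_add (hA.integrable_inner F G₁) (hA.integrable_inner F G₂)]
        refine integral_congr_ae ?_
        filter_upwards [Lp.coeFn_add G₁ G₂] with x hx
        rw [hx, Pi.add_apply, inner_add_right])
      (fun c F G => by
        rw [smul_eq_mul, ← integral_const_mul]
        refine integral_congr_ae ?_
        filter_upwards [Lp.coeFn_smul c G] with x hx
        rw [hx, Pi.smul_apply, real_inner_smul_right]))
    aUp fun F G => by
      rw [LinearMap.mk₂_apply]
      refine (norm_integral_le_of_norm_le ((integrable_norm_mul_norm_lp F G).const_mul aUp)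
        ?_).trans ?_
      · filter_upwards [hA.norm_inner_le] with x hx
        exact hx _ _
      · rw [integral_const_mul, mul_assoc]
        gcongr
        exact integral_norm_mul_norm_lp_le F G

theorem IsEllipticMatrix.form_apply (hA : IsEllipticMatrix A aLow aUp) (haUp : 0 ≤ aUp)
    (F G : Lp (Rn N) 2 (volume : Measure (Rn N))) :
    hA.form haUp F G = ∫ x, inner ℝ (Matrix.toEuclideanLin (A x) (F x)) (G x) := rfl

theorem IsEllipticMatrix.le_form_self (hA : IsEllipticMatrix A aLow aUp) (haUp : 0 ≤ aUp)
    (F : Lp (Rn N) 2 (volume : Measure (Rn N))) : aLow * ‖F‖ ^ 2 ≤ hA.form haUp F F := by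
  rw [hA.form_apply, norm_lp_two_sq, ← integral_const_mul]
  refine integral_mono_ae ?_ (hA.integrable_inner F F) ?_
  · simpa [sq] using (integrable_norm_mul_norm_lp F F).const_mul aLow
  · filter_upwards [hA.2] with x hx
    exact (hx (F x) (F x)).1

end Form

/-! ### The functional defined by the datum `f` -/

section Functional

variable {N : ℕ}

theorem IsSobolevPair.holderConjugate (hN : 1 ≤ N) {σ : ℝ} (hσ0 : 0 < σ) {p q : ℝ≥0∞}
    (h : IsSobolevPair N σ p q) : q.HolderConjugate p := by
  have hN' : (1 : ℝ) ≤ N := by exact_mod_cast hN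
  rcases h with ⟨hσ, rfl, rfl⟩ | ⟨-, -, r, hr, rfl, rfl⟩ | ⟨-, -, rfl, rfl⟩
  · have h1 : 0 < (N : ℝ) - 2 * σ := by linarith
    have h2 : 0 < (N : ℝ) + 2 * σ := by linarith
    refine Real.HolderConjugate.ennrealOfReal (Real.HolderConjugate.symm ?_)
    rw [Real.holderConjugate_iff]
    constructor
    · rw [lt_div_iff₀ h1]; linarith
    · rw [inv_div, inv_div]; field_simp; ring
  · refine Real.HolderConjugate.ennrealOfReal (Real.HolderConjugate.symm ?_)
    exact (Real.holderConjugate_iff_eq_conjExponent hr).2 rfl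
  · infer_instance

/-- The infimum is itself admissible: divide by the norm when it is nonzero; when it is zero, any
one admissible constant suffices, and finiteness of the infimum provides one. -/
theorem eLpNorm_le_sobolevConst {Ω : Set (Rn N)} {σ : ℝ} {p : ℝ≥0∞}
    (hfin : sobolevConst Ω σ p ≠ ⊤) {u : Lp ℝ 2 (volume : Measure (Rn N))} (hu : u ∈ H0 Ω σ) :
    eLpNorm u p (volume.restrict Ω) ≤ sobolevConst Ω σ p * ENNReal.ofReal (normH σ u) := by
  rcases eq_or_ne (ENNReal.ofReal (normH σ u)) 0 with h0 | h0
  · have hne : {C | ∀ u ∈ H0 Ω σ,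
        eLpNorm u p (volume.restrict Ω) ≤ C * ENNReal.ofReal (normH σ u)}.Nonempty := by
      by_contra hemp
      rw [Set.not_nonempty_iff_eq_empty] at hemp
      exact hfin (by rw [sobolevConst, hemp, sInf_empty])
    obtain ⟨C, hC⟩ := hne
    have := hC u hu
    rw [h0, mul_zero] at this ⊢
    exact this
  · rw [← ENNReal.div_le_iff h0 ENNReal.ofReal_ne_top]
    refine le_sInf fun C hC => ?_
    rw [ENNReal.div_le_iff h0 ENNReal.ofReal_ne_top]
    exact hC u hu

theorem eLpNorm_mul_one_le {X : Type*} [MeasurableSpace X] {μ : Measure X} {p q : ℝ≥0∞}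
    [hpq : q.HolderConjugate p] {f g : X → ℝ} (hf : AEStronglyMeasurable f μ)
    (hg : AEStronglyMeasurable g μ) :
    eLpNorm (fun x => f x * g x) 1 μ ≤ eLpNorm f q μ * eLpNorm g p μ := by
  have h := eLpNorm_le_eLpNorm_mul_eLpNorm_of_nnnorm (p := q) (q := p) (r := 1) hf hg
    (fun a b : ℝ => a * b) 1 (Filter.Eventually.of_forall fun x => by simp)
  rwa [ENNReal.coe_one, one_mul] at h

/-- The functional `v ↦ ∫_Ω f v`, through the parametrization of `H^σ_0(Ω)` by gradients. -/
theorem exists_functional {Ω : Set (Rn N)} {σ : ℝ} {p q : ℝ≥0∞} (hpq : q.HolderConjugate p)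
    {f : Rn N → ℝ} (hf : MemLp f q (volume.restrict Ω))
    (hfin : sobolevConst Ω σ p = ⊤ → eLpNorm f q (volume.restrict Ω) = 0)
    {D : Submodule ℝ (Lp (Rn N) 2 (volume : Measure (Rn N)))}
    (L : D →ₗ[ℝ] Lp ℝ 2 (volume : Measure (Rn N)))
    (hL : ∀ d, L d ∈ H0 Ω σ ∧ sigmaGrad σ (L d) = d) :
    ∃ ℓ : D →L[ℝ] ℝ, (∀ d, ℓ d = ∫ x in Ω, f x * L d x) ∧
      ∀ d, |ℓ d| ≤ (sobolevConst Ω σ p * eLpNorm f q (volume.restrict Ω)).toReal * ‖d‖ := by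
  -- If no finite Sobolev constant is available, `f` vanishes a.e. on `Ω` and the functional is `0`.
  by_cases htop : sobolevConst Ω σ p = ⊤
  · have h0 := hfin htop
    have hq : q ≠ 0 := ENNReal.HolderConjugate.ne_zero q p
    rw [eLpNorm_eq_zero_iff hf.1 hq] at h0
    refine ⟨0, fun d => ?_, fun d => by simp; positivity⟩
    symm
    refine integral_eq_zero_of_ae ?_
    filter_upwards [h0] with x hx
    simp [hx]
  · have hb : ∀ d, eLpNorm (L d) p (volume.restrict Ω) ≤
        sobolevConst Ω σ p * ENNReal.ofReal ‖d‖ := fun d => by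
      have := eLpNorm_le_sobolevConst htop (hL d).1
      rwa [normH, (hL d).2] at this
    have hm : ∀ d, MemLp (L d) p (volume.restrict Ω) := fun d =>
      ⟨(Lp.aestronglyMeasurable _).restrict, (hb d).trans_lt
        (ENNReal.mul_lt_top (lt_top_iff_ne_top.2 htop) ENNReal.ofReal_lt_top)⟩
    have hI : ∀ d, Integrable (fun x => f x * L d x) (volume.restrict Ω) := fun d =>
      hf.integrable_mul (hm d)
    have hbound : ∀ d, ‖∫ x in Ω, f x * L d x‖ ≤
        (sobolevConst Ω σ p * eLpNorm f q (volume.restrict Ω)).toReal * ‖d‖ := fun d => by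
      have h1 : eLpNorm (fun x => f x * L d x) 1 (volume.restrict Ω) ≤
          eLpNorm f q (volume.restrict Ω) * eLpNorm (L d) p (volume.restrict Ω) :=
        eLpNorm_mul_one_le hf.1 (hm d).1
      have h2 : eLpNorm (fun x => f x * L d x) 1 (volume.restrict Ω) ≤
          sobolevConst Ω σ p * eLpNorm f q (volume.restrict Ω) * ENNReal.ofReal ‖d‖ := by
        refine h1.trans ((mul_le_mul_right (hb d) _).trans_eq ?_)
        ring
      refine (norm_integral_le_integral_norm _).trans ?_
      rw [integral_norm_eq_lintegral_enorm (hI d).1, ← eLpNorm_one_eq_lintegral_enorm,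
        ← ENNReal.toReal_ofReal (norm_nonneg d), ← ENNReal.toReal_mul]
      exact ENNReal.toReal_mono (ENNReal.mul_ne_top (ENNReal.mul_ne_top htop hf.2.ne)
        ENNReal.ofReal_ne_top) h2
    refine ⟨LinearMap.mkContinuous
      { toFun := fun d => ∫ x in Ω, f x * L d x
        map_add' := fun d e => by
          rw [← integral_add (hI d) (hI e)]
          refine integral_congr_ae (ae_restrict_of_ae ?_)
          rw [map_add]
          filter_upwards [Lp.coeFn_add (L d) (L e)] with x hx
          rw [hx, Pi.add_apply, mul_add]
        map_smul' := fun c d => by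
          rw [RingHom.id_apply, smul_eq_mul, ← integral_const_mul]
          refine integral_congr_ae (ae_restrict_of_ae ?_)
          rw [map_smul]
          filter_upwards [Lp.coeFn_smul c (L d)] with x hx
          rw [hx, Pi.smul_apply, smul_eq_mul, mul_left_comm] } _ hbound, fun d => rfl, hbound⟩

end Functional

/-! ### The gradient constraint as a gauge family of closed convex sets -/

section Constraint

variable {N : ℕ} (D : Submodule ℝ (Lp (Rn N) 2 (volume : Measure (Rn N)))) (φ : Rn N → ℝ)

/-- The gradients in `D` bounded by `t φ`. -/
def gradientConstraint (t : ℝ) : Set D :=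
  {d | ∀ᵐ x, ‖(d : Lp (Rn N) 2 (volume : Measure (Rn N))) x‖ ≤ φ x * t}

theorem isClosed_gradientConstraint (t : ℝ) : IsClosed (gradientConstraint D φ t) := by
  have h : IsClosed {f : Lp (Rn N) 2 (volume : Measure (Rn N)) |
      ∀ᵐ x, f x ∈ {y : Rn N | ‖y‖ ≤ φ x * t}} :=
    isClosed_setOf_ae_mem fun x => isClosed_le continuous_norm continuous_const
  exact h.preimage continuous_subtype_val

theorem convex_gradientConstraint (t : ℝ) : Convex ℝ (gradientConstraint D φ t) := by
  intro d hd e he a b ha hb hab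
  filter_upwards [hd, he, Lp.coeFn_add (a • d.1) (b • e.1), Lp.coeFn_smul a d.1,
    Lp.coeFn_smul b e.1] with x h₁ h₂ h₃ h₄ h₅
  change ‖(a • d.1 + b • e.1 : Lp (Rn N) 2 (volume : Measure (Rn N))) x‖ ≤ _
  rw [h₃, Pi.add_apply, h₄, h₅, Pi.smul_apply, Pi.smul_apply]
  refine (norm_add_le _ _).trans ?_
  rw [norm_smul, norm_smul, Real.norm_of_nonneg ha, Real.norm_of_nonneg hb]
  calc a * ‖d.1 x‖ + b * ‖e.1 x‖ ≤ a * (φ x * t) + b * (φ x * t) := by gcongr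
    _ = φ x * t := by rw [← add_mul, hab, one_mul]

theorem smul_mem_gradientConstraint {s t : ℝ} (hs : 0 < s) {d : D}
    (hd : d ∈ gradientConstraint D φ t) : s • d ∈ gradientConstraint D φ (s * t) := by
  filter_upwards [hd, Lp.coeFn_smul s d.1] with x h₁ h₂
  change ‖(s • d.1 : Lp (Rn N) 2 (volume : Measure (Rn N))) x‖ ≤ _
  rw [h₂, Pi.smul_apply, norm_smul, Real.norm_of_nonneg hs.le, mul_left_comm]
  gcongr

theorem zero_mem_gradientConstraint (hφ : ∀ᵐ x, 0 ≤ φ x) {t : ℝ} (ht : 0 ≤ t) :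
    (0 : D) ∈ gradientConstraint D φ t := by
  filter_upwards [hφ, Lp.coeFn_zero (Rn N) 2 (volume : Measure (Rn N))] with x h₁ h₂
  change ‖(0 : Lp (Rn N) 2 (volume : Measure (Rn N))) x‖ ≤ _
  rw [h₂, Pi.zero_apply, norm_zero]
  positivity

end Constraint

end SigmaGrad

/-! ### Translation to gradients and conclusion -/

namespace SigmaGrad

open MeasureTheory

/-- The quasi-variational inequality in terms of the gradients. -/
theorem isQVISolution_iff {N : ℕ} {Ω : Set (Rn N)} {σ : ℝ}
    {A : Rn N → Matrix (Fin N) (Fin N) ℝ} {aLow aUp : ℝ} (hA : IsEllipticMatrix A aLow aUp)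
    (haUp : 0 ≤ aUp) {f : Rn N → ℝ} {φ : Rn N → ℝ} {Γ : H0 Ω σ → ℝ}
    {D : Submodule ℝ (Lp (Rn N) 2 (volume : Measure (Rn N)))}
    {L : D →ₗ[ℝ] Lp ℝ 2 (volume : Measure (Rn N))}
    (hL : ∀ d, L d ∈ H0 Ω σ ∧ sigmaGrad σ (L d) = d) (hsurj : ∀ u ∈ H0 Ω σ, ∃ d, L d = u)
    {ℓ : D →L[ℝ] ℝ} (hℓ : ∀ d, ℓ d = ∫ x in Ω, f x * L d x) (d : D) :
    IsQVISolution Ω σ A f (fun w x => φ x * Γ w) ⟨L d, (hL d).1⟩ ↔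
      IsVISolution ((hA.form haUp).bilinearComp D.subtypeL D.subtypeL) ℓ
        (gradientConstraint D φ (Γ ⟨L d, (hL d).1⟩)) d := by
  have hmem : ∀ (t : ℝ) (e : D), L e ∈ constraintSet Ω σ (fun x => φ x * t) ↔
      e ∈ gradientConstraint D φ t := fun t e => by
    simp only [constraintSet, Set.mem_ofPred_eq, (hL e).2, (hL e).1, true_and]
    rfl
  have hint : ∀ e : D, ∫ x in Ω, f x * (L e x - L d x) = ℓ (e - d) := fun e => by
    rw [hℓ, map_sub]
    refine integral_congr_ae (ae_restrict_of_ae ?_)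
    filter_upwards [Lp.coeFn_sub (L e) (L d)] with x hx
    rw [hx, Pi.sub_apply]
  have hform : ∀ e : D, ∫ x, inner ℝ (Matrix.toEuclideanLin (A x) (sigmaGrad σ (L d) x))
      (sigmaGrad σ (L e - L d) x) =
        (hA.form haUp).bilinearComp D.subtypeL D.subtypeL d (e - d) := fun e => by
    have h : sigmaGrad σ (L e - L d) = ((e - d : D) : Lp (Rn N) 2 (volume : Measure (Rn N))) := by
      rw [← map_sub]
      exact (hL (e - d)).2
    rw [(hL d).2, h]
    exact (hA.form_apply haUp _ _).symm
  refine and_congr (hmem _ d) ⟨fun h e he => ?_, fun h v hv => ?_⟩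
  · exact (hint e).symm.le.trans ((h (L e) ((hmem _ e).2 he)).trans (hform e).le)
  · obtain ⟨e, rfl⟩ := hsurj v hv.1
    exact (hint e).le.trans ((h e ((hmem _ e).1 hv)).trans (hform e).symm.le)

end SigmaGrad

theorem mainTheorem8 (N : ℕ) (hN : 1 ≤ N)
    (Ω : Set (SigmaGrad.Rn N)) (hΩo : IsOpen Ω) (hΩb : Bornology.IsBounded Ω)
    (σ : ℝ) (hσ0 : 0 < σ) (hσ1 : σ < 1)
    (p q : ENNReal) (hpq : SigmaGrad.IsSobolevPair N σ p q)
    (A : SigmaGrad.Rn N → Matrix (Fin N) (Fin N) ℝ) (aLow aUp : ℝ)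
    (haLow : 0 < aLow) (haUp : 0 < aUp) (hA : SigmaGrad.IsEllipticMatrix A aLow aUp)
    (f : SigmaGrad.Rn N → ℝ)
    (hf : MeasureTheory.MemLp f q (MeasureTheory.volume.restrict Ω))
    (ν : ℝ) (hν : 0 < ν) (φ : SigmaGrad.Rn N → ℝ)
    (hφ : MeasureTheory.MemLp φ ⊤ MeasureTheory.volume)
    (hφν : ∀ᵐ x ∂(MeasureTheory.volume : MeasureTheory.Measure (SigmaGrad.Rn N)), ν ≤ φ x)
    (Γ : SigmaGrad.H0 Ω σ → ℝ) (η E γ : ℝ → ℝ)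
    (hη : MonotoneOn η (Set.Ici 0)) (hE : MonotoneOn E (Set.Ici 0))
    (hγ : MonotoneOn γ (Set.Ici 0))
    (hpos : ∀ R, 0 ≤ R → 0 < η R ∧ 0 < E R ∧ 0 < γ R)
    (R₀ : ℝ) (hR₀ : R₀ ≤ SigmaGrad.radius Ω σ p q aLow f)
    (hΓ_bound : ∀ R, 0 < R → R₀ ≤ R → ∀ u : SigmaGrad.H0 Ω σ,
      SigmaGrad.normH σ u.1 ≤ R → η R ≤ Γ u ∧ Γ u ≤ E R)
    (hΓ_lip : ∀ R, 0 < R → R₀ ≤ R → ∀ u₁ u₂ : SigmaGrad.H0 Ω σ,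
      SigmaGrad.normH σ u₁.1 ≤ R → SigmaGrad.normH σ u₂.1 ≤ R →
        |Γ u₁ - Γ u₂| ≤ γ R * SigmaGrad.normH σ (u₁.1 - u₂.1))
    (hsmall : 2 * SigmaGrad.cSharp Ω σ p aLow *
        ENNReal.ofReal (γ (SigmaGrad.radius Ω σ p q aLow f) /
          η (SigmaGrad.radius Ω σ p q aLow f)) *
        MeasureTheory.eLpNorm f q (MeasureTheory.volume.restrict Ω) < 1) :
    ∃! u : SigmaGrad.H0 Ω σ,
      SigmaGrad.IsQVISolution Ω σ A f (fun w x => φ x * Γ w) u := by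
  obtain ⟨D, L, hDcl, hL, hsurj⟩ := SigmaGrad.exists_gradient_space hN hσ0 hσ1 hΩb
  have hDc : CompleteSpace D := hDcl.completeSpace_coe
  have hconj := hpq.holderConjugate hN hσ0
  set r := SigmaGrad.radius Ω σ p q aLow f with hr
  have hr0 : 0 ≤ r := ENNReal.toReal_nonneg
  set e := MeasureTheory.eLpNorm f q (MeasureTheory.volume.restrict Ω) with he
  have hrM : (SigmaGrad.sobolevConst Ω σ p * e).toReal = aLow * r := by
    rw [hr, SigmaGrad.radius, ← he, SigmaGrad.cSharp, ENNReal.toReal_mul, ENNReal.toReal_mul,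
      ENNReal.toReal_div, ENNReal.toReal_ofReal haLow.le]
    field_simp
  -- The smallness condition, read in `[0, ∞]`, forces `C_*` to be finite or `f` to vanish:
  -- otherwise its left side would be `∞`. The Sobolev embedding itself is thus not needed.
  have hfin : SigmaGrad.sobolevConst Ω σ p = ⊤ → e = 0 := by
    intro htop
    by_contra hne
    have hq : 0 < γ r / η r := div_pos (hpos r hr0).2.2 (hpos r hr0).1
    rw [SigmaGrad.cSharp, htop, ENNReal.top_div_of_ne_top ENNReal.ofReal_ne_top,
      ENNReal.mul_top two_ne_zero, ENNReal.top_mul (ENNReal.ofReal_pos.2 hq).ne',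
      ENNReal.top_mul hne] at hsmall
    exact not_top_lt hsmall
  have hsmall' : 2 * r * (γ r / η r) < 1 := by
    have h := ENNReal.toReal_strict_mono ENNReal.one_ne_top hsmall
    rw [ENNReal.toReal_mul, ENNReal.toReal_mul, ENNReal.toReal_mul, ENNReal.toReal_ofReal
      (div_pos (hpos r hr0).2.2 (hpos r hr0).1).le, ENNReal.toReal_one,
      ENNReal.toReal_ofNat] at h
    have h1 : r = (SigmaGrad.cSharp Ω σ p aLow).toReal * e.toReal := ENNReal.toReal_mul
    generalize γ r / η r = k at h ⊢
    rw [h1]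
    linarith
  obtain ⟨ℓ, hℓ, hℓb⟩ := SigmaGrad.exists_functional hconj hf hfin L hL
  have hnormH : ∀ d, SigmaGrad.normH σ (L d) = ‖d‖ := fun d => by
    rw [SigmaGrad.normH, (hL d).2]; rfl
  -- The bounds on `Γ` are given only for positive radii. If `r = 0`, the radius `1` serves, as the
  -- contraction factor is then `0`.
  obtain ⟨R, hR0, hRr, hRs⟩ : ∃ R, 0 < R ∧ r ≤ R ∧ 2 * r * (γ R / η R) < 1 := by
    rcases hr0.eq_or_lt with h | h
    · exact ⟨1, one_pos, by linarith, by rw [← h]; simp⟩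
    · exact ⟨r, h, le_rfl, hsmall'⟩
  -- Positivity is needed on the whole space, so the lower bound is used at a radius depending on
  -- `d`.
  have hΓpos : ∀ d, 0 < Γ ⟨L d, (hL d).1⟩ := fun d => by
    have hm : 0 < max ‖d‖ R := lt_max_of_lt_right hR0
    exact (hpos _ hm.le).1.trans_le (hΓ_bound (max ‖d‖ R) hm
      (hR₀.trans (hRr.trans (le_max_right _ _))) ⟨L d, (hL d).1⟩
      ((hnormH d).trans_le (le_max_left _ _))).1
  have hφ0 : ∀ᵐ x ∂(MeasureTheory.volume : MeasureTheory.Measure (SigmaGrad.Rn N)), 0 ≤ φ x := by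
    filter_upwards [hφν] with x hx
    exact hν.le.trans hx
  obtain ⟨d, hd, hduniq⟩ := SigmaGrad.existsUnique_isVISolution_gauge
    ((hA.form haUp.le).bilinearComp D.subtypeL D.subtypeL) haLow
    (fun u => hA.le_form_self haUp.le u) ℓ hr0
    (fun v => (hℓb v).trans_eq (by rw [← hrM]))
    (K := SigmaGrad.gradientConstraint D φ)
    (fun t ht => SigmaGrad.zero_mem_gradientConstraint D φ hφ0 ht.le)
    (fun t _ => SigmaGrad.isClosed_gradientConstraint D φ t)
    (fun t _ => SigmaGrad.convex_gradientConstraint D φ t)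
    (fun s t hs _ v hv => SigmaGrad.smul_mem_gradientConstraint D φ hs hv)
    (fun d => Γ ⟨L d, (hL d).1⟩) hΓpos (hpos R hR0.le).1 (hpos R hR0.le).2.2.le
    (fun u hu => (hΓ_bound R hR0 (hR₀.trans hRr) ⟨L u, (hL u).1⟩
      ((hnormH u).trans_le (hu.trans hRr))).1)
    (fun u v hu hv => by
      have h := hΓ_lip R hR0 (hR₀.trans hRr) ⟨L u, (hL u).1⟩ ⟨L v, (hL v).1⟩
        ((hnormH u).trans_le (hu.trans hRr)) ((hnormH v).trans_le (hv.trans hRr))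
      rwa [← map_sub, hnormH] at h)
    hRs
  refine ⟨⟨L d, (hL d).1⟩, (SigmaGrad.isQVISolution_iff hA haUp.le hL hsurj hℓ d).2 hd, ?_⟩
  rintro ⟨u, hu⟩ hsol
  obtain ⟨d', rfl⟩ := hsurj u hu
  have h := hduniq d' ((SigmaGrad.isQVISolution_iff hA haUp.le hL hsurj hℓ d').1 hsol)
  subst h
  rfl
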